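/- **Model.** A machine has state space $\mathbb N=\{0,1,2,\dots\}$ ($0$ = as-good-as-new), discount factor $\beta\in(0,1)$, operation transition probabilities $P^0$, intervention transition probabilities $P^1$, bounded one-period operation costs $K(x,x')$ with $K(x)=\sum_{x'}K(x,x')P^0(x,x')$, bounded intervention costs $C(x)$, and a failure cost $B\in\mathbb R$. Operation is right skip-free with failures: $P^0(x,x)+P^0(x,x+1)+P^0(x,0)=1$ for $x\ge1$ and $P^0(0,0)+P^0(0,1)=1$; $P^0(x,x+1)\le P^0(x+1,x+2)$ for all $x$, and $P^0(x,0)\le P^0(x+1,0)$ for $x\ge 1$. A transition from a state $x\ne0$ to $0$ under operation is a failure; it costs $B$, incurred on arrival at $0$. Interventions are immediate and imperfect: for $x\ge1$, $\sum_{y<x}P^1(x,y)=1$ and $P^1(x,y)>P^1(x,y+1)$ for $y<x$. Let $X(0),X(1),\dots$ be the state process under operation. For a stopping time $\tau$ of this process (possibly infinite, with $\beta^\infty=0$), let $K(x,\tau)$ be the expected total discounted operation and failure cost incurred up to $\tau$ from $X(0)=x$, that is, $$K(x,\tau)=E\Big[\sum_{t<\tau}\big(\beta^tK(X(t))+\beta^{t+1}B\,\mathbf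 1\{X(t)\neq0,\;X(t+1)=0\}\big)\,\Big|\,X(0)=x\Big].$$ Let $\tau(y,x)$ be the first time $t\ge1$ with $X(t)=x$ when $X(0)=y$. The Gittins index for operation is $$G(x)=\inf_{\tau\ge1}\frac{K(x,\tau)+E[\beta^\tau C(X(\tau))\mid x]-C(x)}{1-E[\beta^\tau\mid x]},$$ the infimum being over all stopping times $\tau\ge 1$ of the state process. For an intervention charge $W\in\mathbb R$ and $x\ge 1$, let $\mathfrak B(x,W)=W+\sum_{y<x}P^1(x,y)B_y(x,W)$, where $B_y(x,W)$ is the expected infinite-horizon discounted cost, from state $y$, of the policy that operates the machine and, each time it is found in $x$, immediately intervenes at cost $C(x)+W$ and goes on operating from a state drawn from $P^1(x,\cdot)$. At $x=0$ put $\mathfrak B(0,W)=W$. The operation set is $\Pi(W)=\{x: G(x)\le\mathfrak B(x,W)\}$; the machine is indexable if $\Pi(W_1)\subseteq\Pi(W_2)$ whenever $W_1\le W_2$, and its $W$-index is $W(x)=\inf\{W: x\in\Pi(W)\}$. **Explicit quantities.** Put $$\delta(x)=\frac{\beta P^0(x,x+1)}{1-\beta P^0(x,x)},\quad \kappa(x)=\frac{K(x)}{1-\beta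 P^0(x,x)},\quad \gamma(x)=\frac{\beta P^0(x,0)}{1-\beta P^0(x,x)}\ (x\ge1),\quad \gamma(0)=0,$$ $$D(x)=1-\sum_{i=0}^{x-1}\gamma(i)\prod_{z=0}^{i-1}\delta(z),\qquad b(y,x)=\frac{D(y)}{D(x)}\prod_{h=y}^{x-1}\delta(h)\quad(y\le x),$$ $$k_0(x)=\frac1{D(x)}\sum_{y=0}^{x-1}\big(\kappa(y)+\gamma(y)B\big)\prod_{z=0}^{y-1}\delta(z),$$ and define $k(y,x)$ for $y\le x$ by $k(x,x)=0$ and $$k(y,x)=\frac{\kappa(y)+\gamma(y)(k_0(y)+B)}{1-\gamma(y)b(0,y)}+b(y,y+1)\,k(y+1,x)\qquad(y<x).$$ Let $H(0)=\dfrac{K(0)+\beta P^0(0,0)C(0)+\beta P^0(0,1)C(1)-C(0)}{1-\beta}$ and, for $x\ge1$, $$H(x)=\frac{K(x)+\beta P^0(x,0)\big(k_0(x)+B\big)+\beta P^0(x,x)C(x)+\beta P^0(x,x+1)C(x+1)+\beta P^0(x,0)\,b(0,x)\,C(x)-C(x)}{1-\big(\beta(1-P^0(x,0))+\beta P^0(x,0)\,b(0,x)\big)}.$$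 **Statement.** Suppose that $H$ is increasing (non-strictly suffices). Then $H(x)=G(x)$ for all $x\in\mathbb N$. Moreover the machine is indexable, for all $0\le y<x$ one has $E\beta^{\tau(y,x)}=b(y,x)$ and $K(y,\tau(y,x))=k(y,x)$, and for every $x\ge1$ the $W$-index is $$W(x)=H(x)\Big(1-\sum_{y=0}^{x-1}P^1(x,y)\,b(y,x)\Big)-\Big(\sum_{y=0}^{x-1}P^1(x,y)\,b(y,x)\Big)C(x)-\sum_{y=0}^{x-1}P^1(x,y)\,K(y,\tau(y,x)).$$ All the infima above (for $G$ at every state and for $W(x)$ at $x\geq 1$) are infima of non-empty sets that are bounded below. -/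

import Mathlib

open MeasureTheory ProbabilityTheory

/-- The Markov kernel on histories up to time `n` that draws the next state of a Markov chain with
one-step transition laws `P` from the current state. -/
noncomputable def stepKernel {α : Type} [MeasurableSpace α] [DiscreteMeasurableSpace α]
    [Countable α] (P : α → PMF α) (n : ℕ) : Kernel ((_ : Finset.Iic n) → α) α :=
  (Kernel.ofFunOfCountable fun b : α => (P b).toMeasure).comap
    (fun h => h ⟨n, Finset.mem_Iic.2 le_rfl⟩) (measurable_pi_apply _)

instance stepKernel_isMarkovKernel {α : Type} [MeasurableSpace α] [DiscreteMeasurableSpace α]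
    [Countable α] (P : α → PMF α) (n : ℕ) : IsMarkovKernel (stepKernel P n) :=
  ⟨fun h => PMF.toMeasure.isProbabilityMeasure (P (h ⟨n, Finset.mem_Iic.2 le_rfl⟩))⟩

/-- The law on `ℕ → α` of the time-homogeneous Markov chain with one-step transition laws `P`
started (deterministically) at `a`, obtained from the Ionescu-Tulcea theorem. -/
noncomputable def chainLaw {α : Type} [MeasurableSpace α] [DiscreteMeasurableSpace α] [Countable α]
    (P : α → PMF α) (a : α) : Measure (ℕ → α) :=
  Kernel.traj (X := fun _ : ℕ => α) (stepKernel P) 0 (fun _ => a)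

/-- A single machine with right-skip-free deterioration, failures and imperfect interventions.
The state space is `ℕ`, `0` being the as-good-as-new state. -/
structure Machine where
  /-- discount factor -/
  β : ℝ
  β_pos : 0 < β
  β_lt_one : β < 1
  /-- transition law under operation -/
  P0 : ℕ → PMF ℕ
  /-- transition law under intervention (irrelevant at `0`, where there is nothing to repair) -/
  P1 : ℕ → PMF ℕ
  /-- cost of a one-period operation that leads from the first state to the second -/
  opCost : ℕ → ℕ → ℝ
  /-- cost of an intervention -/
  C : ℕ → ℝ
  /-- cost of a failure, incurred on arrival at `0` after the failure -/
  B : ℝ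
  /-- right skip-free: from `x > 0` the machine stays, moves one step up, or fails (moves to `0`) -/
  skip_free : ∀ x, 0 < x → P0 x x + P0 x (x + 1) + P0 x 0 = 1
  /-- there are no failures at `0` -/
  skip_free_zero : P0 0 0 + P0 0 1 = 1
  /-- deterioration probabilities are non-decreasing -/
  deterioration_mono : ∀ x, P0 x (x + 1) ≤ P0 (x + 1) (x + 2)
  /-- failure probabilities are non-decreasing (the failure probability at `0` being zero) -/
  failure_mono : ∀ x, 0 < x → P0 x 0 ≤ P0 (x + 1) 0
  /-- an intervention at `x` leads to a state `y < x` -/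
  intervention_below : ∀ x, 0 < x → ∑ y ∈ Finset.range x, P1 x y = 1
  /-- large errors of the intervention are less likely than smaller ones -/
  intervention_anti : ∀ x y, 0 < x → y < x → P1 x (y + 1) < P1 x y
  opCost_bounded : ∃ c, ∀ x y, |opCost x y| ≤ c
  C_bounded : ∃ c, ∀ x, |C x| ≤ c

namespace Machine

variable (M : Machine)

/-- The probability `P⁰(x,y)` as a real number. -/
noncomputable def p0 (x y : ℕ) : ℝ := (M.P0 x y).toReal

/-- The probability `P¹(x,y)` as a real number. -/
noncomputable def p1 (x y : ℕ) : ℝ := (M.P1 x y).toReal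

/-- `K(x)`: expected cost of operating the machine for one period in state `x`. -/
noncomputable def K (x : ℕ) : ℝ := ∑' y, M.opCost x y * M.p0 x y

/-! ### The machine under operation -/

/-- The law of the state process `X(0), X(1), …` under operation, started at `x`. -/
noncomputable def opLaw (x : ℕ) : Measure (ℕ → ℕ) := chainLaw M.P0 x

/-- The failure cost incurred in a transition: a failure is a jump from a state `z ≠ 0` to `0`. -/
def failCost (z z' : ℕ) : ℝ := if z ≠ 0 ∧ z' = 0 then M.B else 0

/-- Cost, discounted to the start of a period, of operating during this period with the state
moving from `z` to `z'`. -/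
noncomputable def periodCost (z z' : ℕ) : ℝ := M.K z + M.β * M.failCost z z'

/-- `K(x,τ)`: expected discounted operation and failure cost from `X(0) = x` up to time `τ`. -/
noncomputable def costUntil (x : ℕ) (τ : (ℕ → ℕ) → WithTop ℕ) : ℝ :=
  ∫ ω, ∑' t : ℕ, (open Classical in
    if (t : WithTop ℕ) < τ ω then M.β ^ t * M.periodCost (ω t) (ω (t + 1)) else 0) ∂(M.opLaw x)

/-- `E[β^τ f(X(τ)) | x]`, where `β^∞ = 0`. -/
noncomputable def discountedAt (f : ℕ → ℝ) (x : ℕ) (τ : (ℕ → ℕ) → WithTop ℕ) : ℝ :=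
  ∫ ω, (open Classical in
    if τ ω = ⊤ then 0 else M.β ^ (τ ω).untopD 0 * f (ω ((τ ω).untopD 0))) ∂(M.opLaw x)

/-- `E[β^τ | x]`. -/
noncomputable def discount (x : ℕ) (τ : (ℕ → ℕ) → WithTop ℕ) : ℝ :=
  M.discountedAt (fun _ => 1) x τ

/-- The time `τ(·,x) ≥ 1` of the first entry into state `x`. -/
noncomputable def entryTime (x : ℕ) : (ℕ → ℕ) → WithTop ℕ :=
  hittingAfter (fun (t : ℕ) (ω : ℕ → ℕ) => ω t) {x} 1

/-- The cost rates over which the Gittins index at `x` is the infimum; `τ` ranges over the positive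
stopping times of the state process. -/
noncomputable def gittinsRatios (x : ℕ) : Set ℝ :=
  {r | ∃ τ : (ℕ → ℕ) → WithTop ℕ,
    IsStoppingTime (Filtration.piLE (X := fun _ : ℕ => ℕ)) τ ∧ (∀ ω, 1 ≤ τ ω) ∧
    r = (M.costUntil x τ + M.discountedAt M.C x τ - M.C x) / (1 - M.discount x τ)}

/-- The Gittins index for operation. -/
noncomputable def G (x : ℕ) : ℝ := sInf (M.gittinsRatios x)

/-! ### The policy of immediate intervention and the `W`-index -/

/-- One epoch of the policy that intervenes exactly when the machine is found in state `x`.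
The first component of the state is the state in which the machine is found at the epoch, the
second one is the state in which it is then operated; interventions are immediate. -/
noncomputable def policyStep (x : ℕ) (z : ℕ × ℕ) : PMF (ℕ × ℕ) :=
  (M.P0 z.2).bind fun s =>
    if s = x then (M.P1 x).map fun y => (s, y) else PMF.pure (s, s)

/-- Infinite-horizon expected discounted cost, with intervention charge `W`, of the policy that
operates the machine from `y` and intervenes whenever it is found in state `x`. -/
noncomputable def policyCost (x y : ℕ) (W : ℝ) : ℝ :=
  ∫ ω, ∑' t : ℕ, M.β ^ t * ((if (ω t).1 = x then M.C x + W else 0) +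
      M.periodCost (ω t).2 (ω (t + 1)).1) ∂(chainLaw (M.policyStep x) (y, y))

/-- `𝔅(x,W) = E_{y<x|x} B(x,W) + W`: the intervention charge plus the expected cost of the
above policy after an intervention at `x`. -/
noncomputable def frakB (x : ℕ) (W : ℝ) : ℝ :=
  ∑ y ∈ Finset.range x, M.p1 x y * M.policyCost x y W + W

/-- The operation set for the intervention charge `W`. -/
def operationSet (W : ℝ) : Set ℕ := {x | M.G x ≤ M.frakB x W}

/-- Indexability: the operation set is increasing in the charge. -/
def Indexable : Prop := ∀ W₁ W₂ : ℝ, W₁ ≤ W₂ → M.operationSet W₁ ⊆ M.operationSet W₂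

/-- The `W`-index. -/
noncomputable def whittle (x : ℕ) : ℝ := sInf {W : ℝ | x ∈ M.operationSet W}

/-! ### Explicit quantities -/

noncomputable def δ (x : ℕ) : ℝ := M.β * M.p0 x (x + 1) / (1 - M.β * M.p0 x x)

noncomputable def κ (x : ℕ) : ℝ := M.K x / (1 - M.β * M.p0 x x)

noncomputable def γ (x : ℕ) : ℝ :=
  if x = 0 then 0 else M.β * M.p0 x 0 / (1 - M.β * M.p0 x x)

/-- `1 - ∑_{i<x} γ(i) ∏_{z<i} δ(z)`. -/
noncomputable def D (x : ℕ) : ℝ :=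
  1 - ∑ i ∈ Finset.range x, M.γ i * ∏ z ∈ Finset.range i, M.δ z

/-- Closed form for `E β^{τ(y,x)}`, `y < x` (and the value `1` for `y = x`). -/
noncomputable def discHit (y x : ℕ) : ℝ := (∏ h ∈ Finset.Ico y x, M.δ h) * M.D y / M.D x

/-- Closed form for `K(0,τ(0,x))`. -/
noncomputable def costHitZero (x : ℕ) : ℝ :=
  (∑ y ∈ Finset.range x, (M.κ y + M.γ y * M.B) * ∏ z ∈ Finset.range y, M.δ z) / M.D x

/-- Explicit expression for `K(x,τ(x,x+1))`. -/
noncomputable def costNext (x : ℕ) : ℝ :=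
  (M.κ x + M.γ x * (M.costHitZero x + M.B)) / (1 - M.γ x * M.discHit 0 x)

/-- Explicit expression for `K(y,τ(y,y+n))`, by recursion on `n`. -/
noncomputable def costHitAux : ℕ → ℕ → ℝ
  | 0, _ => 0
  | n + 1, y => M.costNext y + M.discHit y (y + 1) * costHitAux n (y + 1)

/-- Recursively computed expression for `K(y,τ(y,x))`, `y < x`. -/
noncomputable def costHit (y x : ℕ) : ℝ := M.costHitAux (x - y) y

/-- The explicit function `H`. -/
noncomputable def H (x : ℕ) : ℝ :=
  if x = 0 then
    (M.K 0 + M.β * M.p0 0 0 * M.C 0 + M.β * M.p0 0 1 * M.C 1 - M.C 0) / (1 - M.β)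
  else
    (M.K x + M.β * M.p0 x 0 * (M.costHitZero x + M.B)
        + M.β * M.p0 x x * M.C x + M.β * M.p0 x (x + 1) * M.C (x + 1)
        + M.β * M.p0 x 0 * M.discHit 0 x * M.C x - M.C x)
      / (1 - (M.β * (1 - M.p0 x 0) + M.β * M.p0 x 0 * M.discHit 0 x))

end Machine

/-! Every expectation is computed by Dynkin's formula: if a bounded v satisfies the one-step
equation along the path before τ, then v(a) is the expected stopped cost plus E[β^τ v(X(τ))]; if v
is everywhere at most its one-step continuation cost, v(a) is a lower bound.

Upward moves have size one, so a passage from y to x visits every state in between, and a failure at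
y is followed by a climb back through y before x is reached. Hence discount factors multiply and
costs add along a passage. This makes `discHit` and `costHit` solve the one-step equations below x
(`discHit_step`, `costHit_step`), which identifies them with the first-entry expectations.

For the Gittins index, let stopping in y cost C(y) + l, and let `stopValue x l` be the value of
climbing to x and stopping there. By `stopping_gap`, one more period of operation in x costs
denH(x)(H(x) - l) more than stopping at once, with denH(x) > 0, so l = H(x) is the break-even
charge. At this charge the one-step equation holds below x, and the time of first return to [x, ∞)
attains the ratio H(x). If H is monotone, continuing is also no cheaper than `stopValue x (H x)` at
and above x (`stopValue_le_continue`), and `stopValue x (H x)` never exceeds the stopping cost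
(`stopValue_le`). Dynkin's inequality then bounds every ratio below by H(x).

For the W-index, the intervention policy renews at each visit to x. Its cost solves a scalar
fixed-point equation, so `frakB x` is affine in W with slope 1/(1 - `meanDisc x`) > 0. Indexability
follows, and the charges admitting x form a closed half-line whose endpoint is the index. -/

section Chain

/-! ### Markov chain laws on path space -/

variable {α : Type} [MeasurableSpace α] [DiscreteMeasurableSpace α] [Countable α]

instance chainLaw_isProbabilityMeasure (P : α → PMF α) (a : α) :
    IsProbabilityMeasure (chainLaw P a) := by
  unfold chainLaw; infer_instance

theorem measurable_path_pair (g : α → α → ℝ) (s t : ℕ) :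
    Measurable fun ω : ℕ → α => g (ω s) (ω t) := by
  have h : Measurable fun p : α × α => g p.1 p.2 :=
    measurable_from_prod_countable_left fun _ => Measurable.of_discrete
  have h2 : Measurable fun ω : ℕ → α => (ω s, ω t) :=
    (measurable_pi_apply s).prodMk (measurable_pi_apply t)
  exact h.comp h2

theorem integrable_of_bounded {Ω : Type*} [MeasurableSpace Ω] {μ : Measure Ω} [IsFiniteMeasure μ]
    {f : Ω → ℝ} (hf : Measurable f) {c : ℝ} (hc : ∀ ω, |f ω| ≤ c) : Integrable f μ :=
  Integrable.of_bound hf.aestronglyMeasurable c (ae_of_all _ hc)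

/-- A trajectory continued from time n keeps its history fixed, so only the coordinate n + 1 remains
random, and its law is the transition law at the current state. -/
theorem integral_traj_stepKernel (P : α → PMF α) (n : ℕ) (h : (_ : Finset.Iic n) → α)
    (g : α → α → ℝ) :
    ∫ ω, g (ω n) (ω (n + 1)) ∂(Kernel.traj (X := fun _ : ℕ => α) (stepKernel P) n h) =
      ∫ y, g (h ⟨n, Finset.mem_Iic.2 le_rfl⟩) y
        ∂(P (h ⟨n, Finset.mem_Iic.2 le_rfl⟩)).toMeasure := by
  have h2 : (Kernel.traj (X := fun _ : ℕ => α) (stepKernel P) n h).map (fun y => y (n + 1)) =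
      (P (h ⟨n, Finset.mem_Iic.2 le_rfl⟩)).toMeasure := by
    rw [← Kernel.map_apply _ (measurable_pi_apply _), Kernel.map_traj_succ_self]
    rfl
  have h3 : ∀ f : α → ℝ, Measurable f := fun f => Measurable.of_discrete
  rw [Kernel.integral_traj _ (measurable_path_pair g n (n + 1)).aestronglyMeasurable, ← h2,
    integral_map (measurable_pi_apply _).aemeasurable (h3 _).aestronglyMeasurable]
  simp [Function.updateFinset]

/-- The conditional law of the next state given the past. -/
theorem setIntegral_chainLaw_step (P : α → PMF α) (a : α) (n : ℕ) {A : Set (ℕ → α)}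
    (hA : MeasurableSet[Filtration.piLE (X := fun _ : ℕ => α) n] A)
    {g : α → α → ℝ} {c : ℝ} (hg : ∀ x y, |g x y| ≤ c) :
    ∫ ω in A, g (ω n) (ω (n + 1)) ∂(chainLaw P a) =
      ∫ ω in A, ∫ y, g (ω n) y ∂(P (ω n)).toMeasure ∂(chainLaw P a) := by
  have hint : Integrable (fun ω : ℕ → α => g (ω n) (ω (n + 1))) (chainLaw P a) :=
    integrable_of_bounded (measurable_path_pair g n (n + 1)) fun ω => hg _ _
  have hle := (Filtration.piLE (X := fun _ : ℕ => α)).le n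
  rw [← setIntegral_condExp hle hint hA]
  refine setIntegral_congr_ae (hle _ hA) ?_
  filter_upwards [Kernel.condExp_traj (X := fun _ : ℕ => α) (κ := stepKernel P) (Nat.zero_le n)
    (x₀ := fun _ => a) hint] with ω hω _
  exact hω.trans (integral_traj_stepKernel P n _ g)

theorem chainLaw_zero (P : α → PMF α) (a : α) : ∀ᵐ ω ∂(chainLaw P a), ω 0 = a := by
  have h : (chainLaw P a).map (Preorder.frestrictLe 0) =
      Measure.dirac (fun _ : Finset.Iic 0 => a) := by
    unfold chainLaw
    rw [Kernel.traj_map_frestrictLe_apply, Kernel.partialTraj_self, Kernel.id_apply]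
  have h2 : ∀ᵐ h ∂((chainLaw P a).map (Preorder.frestrictLe 0)),
      h ⟨0, Finset.mem_Iic.2 le_rfl⟩ = a := by
    rw [h, ae_dirac_iff]
    exact measurableSet_eq_fun (measurable_pi_apply _) measurable_const
  exact ae_of_ae_map (Preorder.measurable_frestrictLe 0).aemeasurable h2

theorem chainLaw_support (P : α → PMF α) (a : α) :
    ∀ᵐ ω ∂(chainLaw P a), ∀ t, ω (t + 1) ∈ (P (ω t)).support := by
  classical
  rw [ae_all_iff]
  intro t
  -- The test function indicates a forbidden transition; its conditional mean is zero and it is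
  -- nonnegative, so it vanishes almost surely.
  have h := setIntegral_chainLaw_step P a t MeasurableSet.univ (c := 1)
    (g := fun x y => if y ∈ (P x).support then 0 else 1) (fun x y => by split_ifs <;> simp)
  have h0 : ∀ x, ∫ y, (if y ∈ (P x).support then (0 : ℝ) else 1) ∂(P x).toMeasure = 0 := by
    intro x
    rw [← PMF.restrict_toMeasure_support, setIntegral_congr_fun (g := fun _ => 0)
      (MeasurableSet.of_discrete)]
    · simp
    · intro y hy
      simp only [if_pos hy]
  simp only [h0, Measure.restrict_univ, integral_zero] at h
  rw [integral_eq_zero_iff_of_nonneg] at h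
  · filter_upwards [h] with ω hω
    by_contra hn
    simp [hn] at hω
  · intro ω; positivity
  · exact integrable_of_bounded
      (measurable_path_pair (fun x y => if y ∈ (P x).support then (0 : ℝ) else 1) t (t + 1))
      (c := 1) fun ω => by split_ifs <;> simp

end Chain

/-! ### Discounted stopped sums and Dynkin's formula -/

section Dynkin

variable {α : Type}

/-- The discounted sum of `g` along the transitions of a path before time `τ`. -/
noncomputable def stoppedSum (β : ℝ) (τ : (ℕ → α) → WithTop ℕ) (g : α → α → ℝ) (ω : ℕ → α) : ℝ :=
  ∑' t : ℕ, (open Classical in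
    if (t : WithTop ℕ) < τ ω then β ^ t * g (ω t) (ω (t + 1)) else 0)

/-- The discounted value of `v` at the state reached at time `τ`. -/
noncomputable def discountedValue (β : ℝ) (τ : (ℕ → α) → WithTop ℕ) (v : α → ℝ) (ω : ℕ → α) : ℝ :=
  open Classical in
    if τ ω = ⊤ then 0 else β ^ (τ ω).untopD 0 * v (ω ((τ ω).untopD 0))

variable {β : ℝ} {τ : (ℕ → α) → WithTop ℕ}

open Classical in
theorem abs_stoppedSum_term_le (hβ : 0 ≤ β) {g : α → α → ℝ} {c : ℝ} (hg : ∀ x y, |g x y| ≤ c)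
    (ω : ℕ → α) (t : ℕ) :
    |if (t : WithTop ℕ) < τ ω then β ^ t * g (ω t) (ω (t + 1)) else 0| ≤ β ^ t * c := by
  have hc : 0 ≤ c := (abs_nonneg _).trans (hg (ω 0) (ω 0))
  split_ifs
  · rw [abs_mul, abs_of_nonneg (pow_nonneg hβ t)]
    exact mul_le_mul_of_nonneg_left (hg _ _) (pow_nonneg hβ t)
  · rw [abs_zero]; positivity

open Classical in
theorem summable_stoppedSum_term (hβ : 0 ≤ β) (hβ1 : β < 1) {g : α → α → ℝ} {c : ℝ}
    (hg : ∀ x y, |g x y| ≤ c) (ω : ℕ → α) :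
    Summable fun t : ℕ => if (t : WithTop ℕ) < τ ω then β ^ t * g (ω t) (ω (t + 1)) else 0 :=
  Summable.of_norm_bounded ((summable_geometric_of_lt_one hβ hβ1).mul_right c)
    fun t => abs_stoppedSum_term_le hβ hg ω t

theorem stoppedSum_add (hβ : 0 ≤ β) (hβ1 : β < 1) {g h : α → α → ℝ} {c d : ℝ}
    (hg : ∀ x y, |g x y| ≤ c) (hh : ∀ x y, |h x y| ≤ d) (ω : ℕ → α) :
    stoppedSum β τ (fun x y => g x y + h x y) ω = stoppedSum β τ g ω + stoppedSum β τ h ω := by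
  unfold stoppedSum
  rw [← (summable_stoppedSum_term hβ hβ1 hg ω).tsum_add (summable_stoppedSum_term hβ hβ1 hh ω)]
  refine tsum_congr fun t => ?_
  split_ifs <;> ring

/-- The sum telescopes pathwise. If τ is infinite, the remainder β^n v(X(n)) tends to 0 because v is
bounded, in agreement with β^∞ = 0. -/
theorem stoppedSum_sub_discounted (hβ : 0 ≤ β) (hβ1 : β < 1) {v : α → ℝ} {c : ℝ}
    (hv : ∀ x, |v x| ≤ c) (ω : ℕ → α) :
    stoppedSum β τ (fun x y => v x - β * v y) ω = v (ω 0) - discountedValue β τ v ω := by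
  classical
  have htel : ∀ n, ∑ t ∈ Finset.range n, β ^ t * (v (ω t) - β * v (ω (t + 1))) =
      v (ω 0) - β ^ n * v (ω n) := by
    intro n
    induction n with
    | zero => simp
    | succ n ih => rw [Finset.sum_range_succ, ih]; ring
  have hbd : ∀ x y, |v x - β * v y| ≤ c + β * c := fun x y => by
    refine (abs_sub _ _).trans (add_le_add (hv x) ?_)
    rw [abs_mul, abs_of_nonneg hβ]
    exact mul_le_mul_of_nonneg_left (hv y) hβ
  unfold stoppedSum discountedValue
  by_cases hτ : τ ω = ⊤
  · have hs := (summable_stoppedSum_term (τ := τ) hβ hβ1 hbd ω).hasSum.tendsto_sum_nat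
    rw [if_pos hτ, sub_zero]
    refine tendsto_nhds_unique hs ?_
    have hlt : ∀ t : ℕ, (t : WithTop ℕ) < ⊤ := WithTop.coe_lt_top
    simp only [hτ, hlt, if_true, htel]
    have h0 : Filter.Tendsto (fun n : ℕ => β ^ n * v (ω n)) Filter.atTop (nhds 0) := by
      refine squeeze_zero_norm (a := fun n => β ^ n * c) (fun n => ?_) ?_
      · rw [norm_mul, Real.norm_eq_abs, Real.norm_eq_abs, abs_of_nonneg (pow_nonneg hβ n)]
        exact mul_le_mul_of_nonneg_left (hv _) (pow_nonneg hβ n)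
      · simpa using (tendsto_pow_atTop_nhds_zero_of_lt_one hβ hβ1).mul_const c
    simpa using h0.const_sub (v (ω 0))
  · obtain ⟨n, hn⟩ := WithTop.ne_top_iff_exists.1 hτ
    rw [if_neg hτ, ← hn, tsum_eq_sum (s := Finset.range n), WithTop.untopD_coe, ← htel]
    · refine Finset.sum_congr rfl fun t ht => ?_
      exact if_pos (WithTop.coe_lt_coe.2 (Finset.mem_range.1 ht))
    · intro t ht
      exact if_neg fun h => ht (Finset.mem_range.2 (WithTop.coe_lt_coe.1 h))

theorem PMF.abs_integral_le [MeasurableSpace α] (p : PMF α) {f : α → ℝ} {c : ℝ} (hf : ∀ x, |f x| ≤ c) :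
    |∫ y, f y ∂p.toMeasure| ≤ c := by
  simpa using norm_integral_le_of_norm_le_const (μ := p.toMeasure) (f := f) (ae_of_all _ hf)

variable [MeasurableSpace α] [DiscreteMeasurableSpace α] [Countable α]

open Classical in
theorem measurable_stoppedSum_term
    (hτ : IsStoppingTime (Filtration.piLE (X := fun _ : ℕ => α)) τ) (g : α → α → ℝ) (t : ℕ) :
    Measurable fun ω : ℕ → α =>
      if (t : WithTop ℕ) < τ ω then β ^ t * g (ω t) (ω (t + 1)) else 0 :=
  Measurable.ite ((Filtration.piLE (X := fun _ : ℕ => α)).le t _ (hτ.measurableSet_gt t))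
    ((measurable_path_pair g t (t + 1)).const_mul _) measurable_const

variable {P : α → PMF α} {a : α}

theorem integral_stoppedSum_eq_tsum (hβ : 0 ≤ β) (hβ1 : β < 1)
    (hτ : IsStoppingTime (Filtration.piLE (X := fun _ : ℕ => α)) τ)
    {g : α → α → ℝ} {c : ℝ} (hg : ∀ x y, |g x y| ≤ c) :
    Integrable (stoppedSum β τ g) (chainLaw P a) ∧
    ∫ ω, stoppedSum β τ g ω ∂(chainLaw P a) =
      ∑' t : ℕ, β ^ t * ∫ ω in {ω | (t : WithTop ℕ) < τ ω}, g (ω t) (ω (t + 1)) ∂(chainLaw P a) := by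
  classical
  have hi : ∀ t : ℕ, Integrable (fun ω : ℕ → α =>
      if (t : WithTop ℕ) < τ ω then β ^ t * g (ω t) (ω (t + 1)) else 0) (chainLaw P a) :=
    fun t => integrable_of_bounded (measurable_stoppedSum_term hτ g t)
      (abs_stoppedSum_term_le hβ hg · t)
  have hs : Summable fun t : ℕ => ∫ ω, ‖if (t : WithTop ℕ) < τ ω then
      β ^ t * g (ω t) (ω (t + 1)) else 0‖ ∂(chainLaw P a) := by
    refine Summable.of_nonneg_of_le (fun t => integral_nonneg fun _ => norm_nonneg _) (fun t => ?_)
      ((summable_geometric_of_lt_one hβ hβ1).mul_right c)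
    refine (integral_mono (hi t).norm (integrable_const (β ^ t * c))
      (abs_stoppedSum_term_le hβ hg · t)).trans ?_
    simp
  constructor
  · refine integrable_of_bounded (c := ∑' t : ℕ, β ^ t * c)
      (measurable_of_tendsto_metrizable (f := fun n ω => ∑ t ∈ Finset.range n,
        if (t : WithTop ℕ) < τ ω then β ^ t * g (ω t) (ω (t + 1)) else 0)
        (fun n => Finset.measurable_sum _ fun t _ => measurable_stoppedSum_term hτ g t)
        (tendsto_pi_nhds.2 fun ω =>
          (summable_stoppedSum_term hβ hβ1 hg ω).hasSum.tendsto_sum_nat)) fun ω => ?_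
    exact tsum_of_norm_bounded (f := fun t : ℕ =>
        if (t : WithTop ℕ) < τ ω then β ^ t * g (ω t) (ω (t + 1)) else 0)
      ((summable_geometric_of_lt_one hβ hβ1).mul_right c).hasSum
      fun t => abs_stoppedSum_term_le hβ hg ω t
  · unfold stoppedSum
    rw [← integral_tsum_of_summable_integral_norm hi hs]
    refine tsum_congr fun t => ?_
    have hA : MeasurableSet {ω | (t : WithTop ℕ) < τ ω} :=
      (Filtration.piLE (X := fun _ : ℕ => α)).le t _ (hτ.measurableSet_gt t)
    rw [← integral_const_mul, ← integral_indicator hA]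
    refine integral_congr_ae (ae_of_all _ fun ω => ?_)
    simp only [Set.indicator_apply]
    rfl

theorem integrable_stoppedSum (hβ : 0 ≤ β) (hβ1 : β < 1)
    (hτ : IsStoppingTime (Filtration.piLE (X := fun _ : ℕ => α)) τ)
    {g : α → α → ℝ} {c : ℝ} (hg : ∀ x y, |g x y| ≤ c) :
    Integrable (stoppedSum β τ g) (chainLaw P a) :=
  (integral_stoppedSum_eq_tsum hβ hβ1 hτ hg).1

theorem integrable_discountedValue (hβ : 0 ≤ β) (hβ1 : β < 1)
    (hτ : IsStoppingTime (Filtration.piLE (X := fun _ : ℕ => α)) τ)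
    {v : α → ℝ} {c : ℝ} (hv : ∀ x, |v x| ≤ c) :
    Integrable (discountedValue β τ v) (chainLaw P a) := by
  have h : discountedValue β τ v =
      fun ω => v (ω 0) - stoppedSum β τ (fun x y => v x - β * v y) ω := by
    funext ω
    rw [stoppedSum_sub_discounted hβ hβ1 hv]; ring
  rw [h]
  refine (integrable_of_bounded (measurable_path_pair (fun x _ => v x) 0 0)
    fun ω => hv _).sub (integrable_stoppedSum hβ hβ1 hτ (c := c + β * c) fun x y => ?_)
  refine (abs_sub _ _).trans (add_le_add (hv x) ?_)
  rw [abs_mul, abs_of_nonneg hβ]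
  exact mul_le_mul_of_nonneg_left (hv y) hβ

/-- The event t < τ is determined by the path up to time t, so each summand may be replaced by its
conditional mean given that past. -/
theorem integral_stoppedSum (hβ : 0 ≤ β) (hβ1 : β < 1)
    (hτ : IsStoppingTime (Filtration.piLE (X := fun _ : ℕ => α)) τ)
    {g : α → α → ℝ} {c : ℝ} (hg : ∀ x y, |g x y| ≤ c) :
    ∫ ω, stoppedSum β τ g ω ∂(chainLaw P a) =
      ∫ ω, stoppedSum β τ (fun x _ => ∫ y, g x y ∂(P x).toMeasure) ω ∂(chainLaw P a) := by
  rw [(integral_stoppedSum_eq_tsum hβ hβ1 hτ hg).2,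
    (integral_stoppedSum_eq_tsum hβ hβ1 hτ fun x _ => (P x).abs_integral_le (hg x)).2]
  refine tsum_congr fun t => ?_
  exact congrArg _ (setIntegral_chainLaw_step P a t (hτ.measurableSet_gt t) hg)

/-- Dynkin's formula for the discounted chain. -/
theorem integral_stoppedSum_add_discountedValue (hβ : 0 ≤ β) (hβ1 : β < 1)
    (hτ : IsStoppingTime (Filtration.piLE (X := fun _ : ℕ => α)) τ)
    {g : α → α → ℝ} {c : ℝ} (hg : ∀ x y, |g x y| ≤ c) {v : α → ℝ} {d : ℝ} (hv : ∀ x, |v x| ≤ d) :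
    ∫ ω, stoppedSum β τ g ω ∂(chainLaw P a) + ∫ ω, discountedValue β τ v ω ∂(chainLaw P a) =
      v a + ∫ ω, stoppedSum β τ (fun x _ => ∫ y, (g x y + β * v y) ∂(P x).toMeasure - v x) ω
        ∂(chainLaw P a) := by
  have hbd : ∀ x y, |-(v x - β * v y)| ≤ d + β * d := fun x y => by
    rw [abs_neg]
    refine (abs_sub _ _).trans (add_le_add (hv x) ?_)
    rw [abs_mul, abs_of_nonneg hβ]
    exact mul_le_mul_of_nonneg_left (hv y) hβ
  have hbd2 : ∀ x y, |g x y + -(v x - β * v y)| ≤ c + (d + β * d) := fun x y =>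
    (abs_add_le _ _).trans (add_le_add (hg x y) (hbd x y))
  have hpath : ∀ᵐ ω ∂(chainLaw P a), stoppedSum β τ g ω + discountedValue β τ v ω =
      v a + stoppedSum β τ (fun x y => g x y + -(v x - β * v y)) ω := by
    filter_upwards [chainLaw_zero P a] with ω h0
    have h1 : stoppedSum β τ (fun x y => -(v x - β * v y)) ω =
        -stoppedSum β τ (fun x y => v x - β * v y) ω := by
      unfold stoppedSum
      rw [← tsum_neg]
      refine tsum_congr fun t => ?_
      split_ifs <;> ring
    rw [stoppedSum_add hβ hβ1 hg hbd, h1, stoppedSum_sub_discounted hβ hβ1 hv, h0]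
    ring
  rw [← integral_add (integrable_stoppedSum hβ hβ1 hτ hg) (integrable_discountedValue hβ hβ1 hτ hv),
    integral_congr_ae hpath, integral_add (integrable_const _)
      (integrable_stoppedSum hβ hβ1 hτ hbd2), integral_stoppedSum hβ hβ1 hτ hbd2]
  congr 1
  · simp
  · refine integral_congr_ae (ae_of_all _ fun ω => ?_)
    refine congrFun (congrArg (stoppedSum β τ) ?_) ω
    funext x _
    have h3 : ∀ f : α → ℝ, Measurable f := fun f => Measurable.of_discrete
    have hi : Integrable (fun y => g x y + β * v y) (P x).toMeasure := by
      refine integrable_of_bounded (h3 _) (c := c + β * d) fun y =>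
        (abs_add_le _ _).trans (add_le_add (hg x y) ?_)
      rw [abs_mul, abs_of_nonneg hβ]
      exact mul_le_mul_of_nonneg_left (hv y) hβ
    calc ∫ y, (g x y + -(v x - β * v y)) ∂(P x).toMeasure
        = ∫ y, ((g x y + β * v y) - v x) ∂(P x).toMeasure := by congr 1; funext y; ring
      _ = _ := by rw [integral_sub hi (integrable_const _)]; simp

theorem le_integral_stoppedSum_add_discountedValue (hβ : 0 ≤ β) (hβ1 : β < 1)
    (hτ : IsStoppingTime (Filtration.piLE (X := fun _ : ℕ => α)) τ)
    {g : α → α → ℝ} {c : ℝ} (hg : ∀ x y, |g x y| ≤ c) {v : α → ℝ} {d : ℝ} (hv : ∀ x, |v x| ≤ d)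
    (h : ∀ x, v x ≤ ∫ y, (g x y + β * v y) ∂(P x).toMeasure) :
    v a ≤ ∫ ω, stoppedSum β τ g ω ∂(chainLaw P a) +
      ∫ ω, discountedValue β τ v ω ∂(chainLaw P a) := by
  rw [integral_stoppedSum_add_discountedValue hβ hβ1 hτ hg hv]
  refine le_add_of_nonneg_right (integral_nonneg fun ω => tsum_nonneg fun t => ?_)
  split_ifs
  · exact mul_nonneg (pow_nonneg hβ t) (sub_nonneg.2 (h _))
  · exact le_rfl

theorem integral_stoppedSum_add_discountedValue_of_harmonic (hβ : 0 ≤ β) (hβ1 : β < 1)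
    (hτ : IsStoppingTime (Filtration.piLE (X := fun _ : ℕ => α)) τ)
    {g : α → α → ℝ} {c : ℝ} (hg : ∀ x y, |g x y| ≤ c) {v : α → ℝ} {d : ℝ} (hv : ∀ x, |v x| ≤ d)
    (h : ∀ᵐ ω ∂(chainLaw P a), ∀ t : ℕ, (t : WithTop ℕ) < τ ω →
      ∫ y, (g (ω t) y + β * v y) ∂(P (ω t)).toMeasure = v (ω t)) :
    ∫ ω, stoppedSum β τ g ω ∂(chainLaw P a) + ∫ ω, discountedValue β τ v ω ∂(chainLaw P a) =
      v a := by
  rw [integral_stoppedSum_add_discountedValue hβ hβ1 hτ hg hv, integral_eq_zero_of_ae, add_zero]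
  filter_upwards [h] with ω hω
  refine (tsum_congr fun t => ?_).trans tsum_zero
  split_ifs with ht
  · simp only [hω t ht, sub_self, mul_zero]
  · rfl

end Dynkin

/-! ### One-step expectations under operation -/

theorem PMF.eq_zero_of_sum_eq_one {α : Type*} (p : PMF α) {s : Finset α}
    (hs : ∑ y ∈ s, p y = 1) {y : α} (hy : y ∉ s) : p y = 0 := by
  classical
  have h := ENNReal.sum_le_tsum (f := fun y => p y) (insert y s)
  rw [Finset.sum_insert hy, hs, p.tsum_coe] at h
  by_contra h0
  exact absurd h (not_le.2 (by
    rw [add_comm]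
    exact ENNReal.lt_add_right ENNReal.one_ne_top h0))

theorem PMF.integral_eq_sum_of_sum_eq_one {α : Type*} [MeasurableSpace α]
    [DiscreteMeasurableSpace α] (p : PMF α) {s : Finset α} (hs : ∑ y ∈ s, p y = 1)
    {f : α → ℝ} {c : ℝ} (hf : ∀ y, |f y| ≤ c) :
    ∫ y, f y ∂p.toMeasure = ∑ y ∈ s, (p y).toReal * f y := by
  have hm : Measurable f := Measurable.of_discrete
  rw [p.integral_eq_tsum f (integrable_of_bounded hm hf), tsum_eq_sum (s := s)]
  · rfl
  · intro y hy
    rw [p.eq_zero_of_sum_eq_one hs hy]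
    simp

namespace Machine

variable (M : Machine)

/-- The probability of a failure in state `x`. -/
noncomputable def failProb (x : ℕ) : ℝ := if x = 0 then 0 else M.p0 x 0

theorem p0_nonneg (x y : ℕ) : 0 ≤ M.p0 x y := ENNReal.toReal_nonneg

theorem failProb_nonneg (x : ℕ) : 0 ≤ M.failProb x := by
  unfold failProb
  split_ifs
  exacts [le_rfl, M.p0_nonneg _ _]

theorem p0_sum (x : ℕ) : M.p0 x x + M.p0 x (x + 1) + M.failProb x = 1 := by
  unfold failProb p0
  have ht := fun y => (M.P0 x).apply_ne_top y
  split_ifs with hx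
  · subst hx
    rw [← ENNReal.toReal_add (ht _) (ht _), M.skip_free_zero]; simp
  · rw [← ENNReal.toReal_add (ht _) (ht _),
      ← ENNReal.toReal_add (ENNReal.add_ne_top.2 ⟨ht _, ht _⟩) (ht _),
      M.skip_free x (Nat.pos_of_ne_zero hx)]
    simp

/-- At x = 0 the three listed states collapse to two; this is why staying in 0 must not be counted a
second time as a failure, and why `failProb 0` is 0. -/
theorem P0_sum_eq_one (x : ℕ) : ∑ y ∈ ({x, x + 1, 0} : Finset ℕ), M.P0 x y = 1 := by
  rcases Nat.eq_zero_or_pos x with rfl | hx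
  · simpa [add_comm] using M.skip_free_zero
  · rw [← M.skip_free x hx, Finset.sum_insert (by simp; omega), Finset.sum_insert (by simp),
      Finset.sum_singleton, add_assoc]

theorem mem_support_P0 {x y : ℕ} (h : y ∈ (M.P0 x).support) : y = x ∨ y = x + 1 ∨ y = 0 := by
  by_contra hn
  exact h ((M.P0 x).eq_zero_of_sum_eq_one (M.P0_sum_eq_one x) (by simpa using hn))

theorem integral_P0 (x : ℕ) {f : ℕ → ℝ} {c : ℝ} (hf : ∀ y, |f y| ≤ c) :
    ∫ y, f y ∂(M.P0 x).toMeasure =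
      M.p0 x x * f x + M.p0 x (x + 1) * f (x + 1) + M.failProb x * f 0 := by
  rw [(M.P0 x).integral_eq_sum_of_sum_eq_one (M.P0_sum_eq_one x) hf]
  unfold failProb p0
  rcases Nat.eq_zero_or_pos x with rfl | hx
  · simp [add_comm]
  · rw [Finset.sum_insert (by simp; omega), Finset.sum_insert (by simp), Finset.sum_singleton,
      if_neg hx.ne']
    ring

theorem K_bounded : ∃ c, ∀ x, |M.K x| ≤ c := by
  obtain ⟨c, hc⟩ := M.opCost_bounded
  refine ⟨c, fun x => ?_⟩
  have h1 : HasSum (fun y => M.p0 x y) 1 := by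
    have h := ENNReal.hasSum_toReal (f := fun y => M.P0 x y) (M.P0 x).tsum_coe_ne_top
    rwa [← ENNReal.tsum_toReal_eq (M.P0 x).apply_ne_top, (M.P0 x).tsum_coe] at h
  have h2 := tsum_of_norm_bounded (f := fun y => M.opCost x y * M.p0 x y) (h1.mul_left c)
    fun y => by
      rw [norm_mul, Real.norm_eq_abs, Real.norm_eq_abs, abs_of_nonneg (M.p0_nonneg x y)]
      exact mul_le_mul_of_nonneg_right (hc x y) (M.p0_nonneg x y)
  rwa [mul_one] at h2

theorem abs_failCost_le (x y : ℕ) : |M.failCost x y| ≤ |M.B| := by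
  unfold failCost
  split_ifs
  · exact le_rfl
  · simp

theorem periodCost_bounded : ∃ c, ∀ x y, |M.periodCost x y| ≤ c := by
  obtain ⟨c, hc⟩ := M.K_bounded
  refine ⟨c + M.β * |M.B|, fun x y => (abs_add_le _ _).trans (add_le_add (hc x) ?_)⟩
  rw [abs_mul, abs_of_pos M.β_pos]
  exact mul_le_mul_of_nonneg_left (M.abs_failCost_le x y) M.β_pos.le

/-- Expected one-period cost plus the discounted value of `v` after the period. -/
theorem integral_periodCost_add (x : ℕ) {v : ℕ → ℝ} {c : ℝ} (hv : ∀ y, |v y| ≤ c) :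
    ∫ y, (M.periodCost x y + M.β * v y) ∂(M.P0 x).toMeasure =
      M.K x + M.β * (M.p0 x x * v x + M.p0 x (x + 1) * v (x + 1) +
        M.failProb x * (M.B + v 0)) := by
  obtain ⟨d, hd⟩ := M.periodCost_bounded
  rw [M.integral_P0 x (c := d + M.β * c) fun y => (abs_add_le _ _).trans (add_le_add (hd x y) (by
    rw [abs_mul, abs_of_pos M.β_pos]
    exact mul_le_mul_of_nonneg_left (hv y) M.β_pos.le))]
  have h := M.p0_sum x
  have h1 : M.p0 x x = 1 - M.p0 x (x + 1) - M.failProb x := by linarith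
  unfold periodCost failCost
  rcases Nat.eq_zero_or_pos x with rfl | hx
  · have h0 : M.failProb 0 = 0 := by simp [failProb]
    rw [h0] at h1 ⊢
    simp only [ne_eq, not_true_eq_false, false_and, if_false]
    simp only [zero_add] at h1 ⊢
    rw [h1]; ring
  · simp only [ne_eq, hx.ne', not_false_eq_true, true_and, and_false, if_true, if_false,
      Nat.add_eq_zero_iff, false_and]
    rw [h1]; ring

/-! ### Algebra of the explicit first-passage quantities -/

theorem one_sub_pos (x : ℕ) : 0 < 1 - M.β * M.p0 x x := by
  have h := M.p0_sum x
  have h1 := M.p0_nonneg x (x + 1)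
  have h2 := M.failProb_nonneg x
  have h3 := M.β_pos
  have h4 := M.β_lt_one
  have h5 : M.p0 x x ≤ 1 := by linarith
  nlinarith [mul_le_mul_of_nonneg_left h5 h3.le]

theorem one_sub_mul_δ (x : ℕ) : (1 - M.β * M.p0 x x) * M.δ x = M.β * M.p0 x (x + 1) :=
  mul_div_cancel₀ _ (M.one_sub_pos x).ne'

theorem one_sub_mul_κ (x : ℕ) : (1 - M.β * M.p0 x x) * M.κ x = M.K x :=
  mul_div_cancel₀ _ (M.one_sub_pos x).ne'

theorem one_sub_mul_γ (x : ℕ) : (1 - M.β * M.p0 x x) * M.γ x = M.β * M.failProb x := by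
  unfold γ failProb
  split_ifs
  · simp
  · exact mul_div_cancel₀ _ (M.one_sub_pos x).ne'

theorem δ_nonneg (x : ℕ) : 0 ≤ M.δ x :=
  div_nonneg (mul_nonneg M.β_pos.le (M.p0_nonneg _ _)) (M.one_sub_pos x).le

theorem γ_nonneg (x : ℕ) : 0 ≤ M.γ x := by
  refine nonneg_of_mul_nonneg_right (a := 1 - M.β * M.p0 x x) ?_ (M.one_sub_pos x)
  rw [M.one_sub_mul_γ]
  exact mul_nonneg M.β_pos.le (M.failProb_nonneg x)

theorem δ_add_γ_lt_one (x : ℕ) : M.δ x + M.γ x < 1 := by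
  have h0 := M.one_sub_pos x
  have h : (1 - M.β * M.p0 x x) * (M.δ x + M.γ x) < (1 - M.β * M.p0 x x) * 1 := by
    rw [mul_add, M.one_sub_mul_δ, M.one_sub_mul_γ]
    have h1 := M.p0_sum x
    have h2 := M.β_lt_one
    have h3 : M.failProb x = 1 - M.p0 x x - M.p0 x (x + 1) := by linarith
    rw [h3]; linarith
  exact lt_of_mul_lt_mul_left h h0.le

theorem prod_δ_nonneg (s : Finset ℕ) : 0 ≤ ∏ z ∈ s, M.δ z :=
  Finset.prod_nonneg fun z _ => M.δ_nonneg z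

theorem D_zero : M.D 0 = 1 := by simp [D]

theorem D_succ (x : ℕ) : M.D (x + 1) = M.D x - M.γ x * ∏ z ∈ Finset.range x, M.δ z := by
  unfold D
  rw [Finset.sum_range_succ]; ring

/-- The two claims need a joint induction: D(x+1) = D(x) - γ(x)∏δ stays positive only because the
product is at most D(x) and γ(x) < 1, and δ + γ < 1 propagates the comparison. -/
theorem prod_le_D_and_pos (x : ℕ) : ∏ z ∈ Finset.range x, M.δ z ≤ M.D x ∧ 0 < M.D x := by
  induction x with
  | zero => simp [D]
  | succ x ih =>
    rw [M.D_succ, Finset.prod_range_succ]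
    have hp := M.prod_δ_nonneg (Finset.range x)
    have h1 := M.δ_add_γ_lt_one x
    have h2 := M.δ_nonneg x
    have h3 := M.γ_nonneg x
    obtain ⟨h4, h5⟩ := ih
    constructor
    · nlinarith
    · nlinarith [mul_le_mul_of_nonneg_left h4 h3]

theorem D_pos (x : ℕ) : 0 < M.D x := (M.prod_le_D_and_pos x).2

theorem discHit_self (x : ℕ) : M.discHit x x = 1 := by
  simp [discHit, (M.D_pos x).ne']

theorem discHit_zero (x : ℕ) : M.discHit 0 x = (∏ z ∈ Finset.range x, M.δ z) / M.D x := by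
  simp [discHit, D_zero]

theorem discHit_nonneg (y x : ℕ) : 0 ≤ M.discHit y x :=
  div_nonneg (mul_nonneg (M.prod_δ_nonneg _) (M.D_pos y).le) (M.D_pos x).le

theorem discHit_mul {y z x : ℕ} (hyz : y ≤ z) (hzx : z ≤ x) :
    M.discHit y z * M.discHit z x = M.discHit y x := by
  unfold discHit
  rw [← Finset.prod_Ico_consecutive _ hyz hzx]
  have := (M.D_pos z).ne'
  have := (M.D_pos x).ne'
  field_simp

theorem discHit_succ (y : ℕ) : M.discHit y (y + 1) = M.δ y * M.D y / M.D (y + 1) := by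
  simp [discHit]

theorem discHit_succ_lt_one (y : ℕ) : M.discHit y (y + 1) < 1 := by
  rw [M.discHit_succ, div_lt_one (M.D_pos _), M.D_succ]
  obtain ⟨h4, h5⟩ := M.prod_le_D_and_pos y
  nlinarith [mul_le_mul_of_nonneg_left h4 (M.γ_nonneg y), M.δ_add_γ_lt_one y]

theorem discHit_le_one {y x : ℕ} (h : y ≤ x) : M.discHit y x ≤ 1 := by
  induction x, h using Nat.le_induction with
  | base => rw [M.discHit_self]
  | succ x h ih =>
    rw [← M.discHit_mul h x.le_succ]
    exact mul_le_one₀ ih (M.discHit_nonneg _ _) (M.discHit_succ_lt_one x).le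

theorem discHit_lt_one {y x : ℕ} (h : y < x) : M.discHit y x < 1 := by
  rw [← M.discHit_mul y.le_succ h]
  exact mul_lt_one_of_nonneg_of_lt_one_left (M.discHit_nonneg _ _) (M.discHit_succ_lt_one y)
    (M.discHit_le_one h)

/-- γ(y)b(0,y) is the discount of an excursion from y through failure back to y. The quotient on the
right is what lets D telescope along a passage. -/
theorem one_sub_γ_mul_discHit (y : ℕ) :
    1 - M.γ y * M.discHit 0 y = M.D (y + 1) / M.D y := by
  rw [M.discHit_zero, M.D_succ]
  have := (M.D_pos y).ne'
  field_simp

theorem one_sub_γ_mul_discHit_pos (y : ℕ) : 0 < 1 - M.γ y * M.discHit 0 y := by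
  rw [M.one_sub_γ_mul_discHit]
  exact div_pos (M.D_pos _) (M.D_pos _)

theorem one_sub_mul_discHit_succ (y : ℕ) :
    (1 - M.γ y * M.discHit 0 y) * M.discHit y (y + 1) = M.δ y := by
  rw [M.one_sub_γ_mul_discHit, M.discHit_succ]
  have := (M.D_pos y).ne'
  have := (M.D_pos (y + 1)).ne'
  field_simp

theorem one_sub_mul_costNext (y : ℕ) :
    (1 - M.γ y * M.discHit 0 y) * M.costNext y = M.κ y + M.γ y * (M.costHitZero y + M.B) :=
  mul_div_cancel₀ _ (M.one_sub_γ_mul_discHit_pos y).ne'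

theorem costHit_self (x : ℕ) : M.costHit x x = 0 := by
  simp [costHit, costHitAux]

theorem costHit_of_lt {y x : ℕ} (h : y < x) :
    M.costHit y x = M.costNext y + M.discHit y (y + 1) * M.costHit (y + 1) x := by
  unfold costHit
  obtain ⟨n, rfl⟩ := Nat.exists_eq_add_of_lt h
  rw [show y + n + 1 - y = n + 1 by omega, show y + n + 1 - (y + 1) = n by omega]
  rfl

theorem costHitZero_succ (y : ℕ) :
    M.costHitZero (y + 1) = M.costHitZero y + M.discHit 0 y * M.costNext y := by
  have h1 := M.one_sub_mul_costNext y
  have hD := (M.D_pos y).ne'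
  have hD1 := (M.D_pos (y + 1)).ne'
  rw [M.one_sub_γ_mul_discHit] at h1
  have h2 : M.costNext y = (M.κ y + M.γ y * (M.costHitZero y + M.B)) * M.D y / M.D (y + 1) := by
    rw [← h1]; field_simp
  rw [h2, M.discHit_zero]
  unfold costHitZero
  rw [Finset.sum_range_succ]
  set S := ∑ x ∈ Finset.range y, (M.κ x + M.γ x * M.B) * ∏ z ∈ Finset.range x, M.δ z
  have h3 := M.D_succ y
  set Q := ∏ z ∈ Finset.range y, M.δ z
  field_simp
  rw [h3]; ring

/-- Additivity of cost when the passage from 0 to x is split at y. At y = 0 it reconciles the closed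
form with the recursion. -/
theorem costHitZero_eq {y x : ℕ} (h : y ≤ x) :
    M.costHitZero x = M.costHitZero y + M.discHit 0 y * M.costHit y x := by
  induction h using Nat.decreasingInduction with
  | self => rw [M.costHit_self]; ring
  | of_succ y h ih =>
    rw [ih, M.costHitZero_succ, M.costHit_of_lt h, ← M.discHit_mul (Nat.zero_le y) y.le_succ]
    ring

theorem costHit_zero (x : ℕ) : M.costHit 0 x = M.costHitZero x := by
  rw [M.costHitZero_eq (Nat.zero_le x), M.discHit_self]
  simp [costHitZero]

theorem discHit_step {y x : ℕ} (h : y < x) :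
    M.β * (M.p0 y y * M.discHit y x + M.p0 y (y + 1) * M.discHit (y + 1) x +
      M.failProb y * M.discHit 0 x) = M.discHit y x := by
  have h1 := M.one_sub_mul_discHit_succ y
  have h2 := M.discHit_mul y.le_succ h
  have h3 := M.discHit_mul (Nat.zero_le y) h.le
  have h4 := M.one_sub_mul_δ y
  have h5 := M.one_sub_mul_γ y
  -- The first departure from y goes up or fails; stays in y are summed out, and the path from 0 to
  -- x factors through y.
  have h6 : M.discHit y x = M.δ y * M.discHit (y + 1) x + M.γ y * M.discHit 0 x := by
    rw [← h1, ← h3]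
    linear_combination (-(1 - M.γ y * M.discHit 0 y)) * h2
  linear_combination (-(1 - M.β * M.p0 y y)) * h6 - M.discHit (y + 1) x * h4 -
    M.discHit 0 x * h5

theorem costHit_step {y x : ℕ} (h : y < x) :
    M.K y + M.β * (M.p0 y y * M.costHit y x + M.p0 y (y + 1) * M.costHit (y + 1) x +
      M.failProb y * (M.B + M.costHit 0 x)) = M.costHit y x := by
  have h1 := M.one_sub_mul_discHit_succ y
  have h2 := M.costHit_of_lt h
  have h3 := M.costHitZero_eq h.le
  have h4 := M.one_sub_mul_δ y
  have h5 := M.one_sub_mul_γ y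
  have h7 := M.one_sub_mul_κ y
  have h8 := M.one_sub_mul_costNext y
  have h6 : M.costHit y x = M.κ y + M.γ y * (M.B + M.costHit 0 x) +
      M.δ y * M.costHit (y + 1) x := by
    rw [M.costHit_zero, h3, ← h1]
    linear_combination (1 - M.γ y * M.discHit 0 y) * h2 + h8
  linear_combination (-(1 - M.β * M.p0 y y)) * h6 - M.costHit (y + 1) x * h4 -
    (M.B + M.costHit 0 x) * h5 - h7

end Machine

/-! ### Stopping times and discounted costs of the machine -/

namespace Machine

variable (M : Machine)

/-- Dynkin's formula asks for bounded functions; only finitely many values are left unbounded by w.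
-/
theorem exists_bound_of_eventually_eq {v w : ℕ → ℝ} {x : ℕ} (h : ∀ z, x ≤ z → v z = w z)
    (hw : ∃ c, ∀ z, |w z| ≤ c) : ∃ c, ∀ z, |v z| ≤ c := by
  obtain ⟨c, hc⟩ := hw
  refine ⟨∑ y ∈ Finset.range x, |v y| + c, fun z => ?_⟩
  have h0 : 0 ≤ c := (abs_nonneg _).trans (hc 0)
  have h1 : 0 ≤ ∑ y ∈ Finset.range x, |v y| := Finset.sum_nonneg fun _ _ => abs_nonneg _
  rcases lt_or_ge z x with hz | hz
  · have := Finset.single_le_sum (f := fun y => |v y|) (fun _ _ => abs_nonneg _)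
      (Finset.mem_range.2 hz)
    linarith
  · rw [h z hz]
    linarith [hc z]

theorem isStoppingTime_hittingAfter (s : Set ℕ) (n : ℕ) :
    IsStoppingTime (Filtration.piLE (X := fun _ : ℕ => ℕ))
      (hittingAfter (fun (t : ℕ) (ω : ℕ → ℕ) => ω t) s n) := by
  refine Adapted.isStoppingTime_hittingAfter (fun t => ?_) MeasurableSet.of_discrete
  have h : Measurable fun p : (_ : Set.Iic t) → ℕ => p ⟨t, Set.mem_Iic.2 le_rfl⟩ :=
    measurable_pi_apply (⟨t, Set.mem_Iic.2 le_rfl⟩ : Set.Iic t)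
  exact h.comp (comap_measurable (Preorder.restrictLe (π := fun _ : ℕ => ℕ) t))

theorem not_mem_of_lt_hittingAfter_one {s : Set ℕ} {ω : ℕ → ℕ} {t : ℕ}
    (ht : (t : WithTop ℕ) < hittingAfter (fun (t : ℕ) (ω : ℕ → ℕ) => ω t) s 1 ω) (h1 : 1 ≤ t) :
    ω t ∉ s :=
  notMem_of_lt_hittingAfter ht h1

theorem mem_of_hittingAfter_ne_top {s : Set ℕ} {ω : ℕ → ℕ}
    (h : hittingAfter (fun (t : ℕ) (ω : ℕ → ℕ) => ω t) s 1 ω ≠ ⊤) :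
    ω ((hittingAfter (fun (t : ℕ) (ω : ℕ → ℕ) => ω t) s 1 ω).untopD 0) ∈ s := by
  have h1 := hittingAfter_mem_set_of_ne_top h
  obtain ⟨n, hn⟩ := WithTop.ne_top_iff_exists.1 h
  rw [← hn] at h1 ⊢
  exact h1

theorem costUntil_eq (x : ℕ) (τ : (ℕ → ℕ) → WithTop ℕ) :
    M.costUntil x τ = ∫ ω, stoppedSum M.β τ M.periodCost ω ∂(chainLaw M.P0 x) := rfl

theorem discountedAt_eq (f : ℕ → ℝ) (x : ℕ) (τ : (ℕ → ℕ) → WithTop ℕ) :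
    M.discountedAt f x τ = ∫ ω, discountedValue M.β τ f ω ∂(chainLaw M.P0 x) := rfl

theorem discountedAt_congr {f g : ℕ → ℝ} {x : ℕ} {τ : (ℕ → ℕ) → WithTop ℕ}
    (h : ∀ ω, τ ω ≠ ⊤ → f (ω ((τ ω).untopD 0)) = g (ω ((τ ω).untopD 0))) :
    M.discountedAt f x τ = M.discountedAt g x τ := by
  refine integral_congr_ae (ae_of_all _ fun ω => ?_)
  by_cases hτ : τ ω = ⊤
  · simp [hτ]
  · simp [hτ, h ω hτ]

theorem discountedAt_le {f g : ℕ → ℝ} {c d : ℝ} (hf : ∀ y, |f y| ≤ c) (hg : ∀ y, |g y| ≤ d)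
    (hfg : ∀ y, f y ≤ g y) (x : ℕ) {τ : (ℕ → ℕ) → WithTop ℕ}
    (hτ : IsStoppingTime (Filtration.piLE (X := fun _ : ℕ => ℕ)) τ) :
    M.discountedAt f x τ ≤ M.discountedAt g x τ := by
  refine integral_mono (integrable_discountedValue M.β_pos.le M.β_lt_one hτ hf)
    (integrable_discountedValue M.β_pos.le M.β_lt_one hτ hg) fun ω => ?_
  dsimp only
  split_ifs
  · exact le_rfl
  · exact mul_le_mul_of_nonneg_left (hfg _) (pow_nonneg M.β_pos.le _)

theorem discountedAt_add_const {f : ℕ → ℝ} {c : ℝ} (hf : ∀ y, |f y| ≤ c) (l : ℝ) (x : ℕ)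
    {τ : (ℕ → ℕ) → WithTop ℕ}
    (hτ : IsStoppingTime (Filtration.piLE (X := fun _ : ℕ => ℕ)) τ) :
    M.discountedAt (fun y => f y + l) x τ = M.discountedAt f x τ + l * M.discount x τ := by
  unfold discount
  simp only [discountedAt_eq]
  rw [← integral_const_mul, ← integral_add
    (integrable_discountedValue M.β_pos.le M.β_lt_one hτ hf)
    ((integrable_discountedValue M.β_pos.le M.β_lt_one hτ (v := fun _ => 1) (c := 1)
      (by simp)).const_mul l)]
  refine integral_congr_ae (ae_of_all _ fun ω => ?_)
  dsimp only [discountedValue]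
  split_ifs <;> ring

theorem discount_lt_one (x : ℕ) {τ : (ℕ → ℕ) → WithTop ℕ}
    (hτ : IsStoppingTime (Filtration.piLE (X := fun _ : ℕ => ℕ)) τ) (h1 : ∀ ω, 1 ≤ τ ω) :
    M.discount x τ < 1 := by
  refine lt_of_le_of_lt ?_ M.β_lt_one
  have h : M.discount x τ ≤ ∫ _, M.β ∂(chainLaw M.P0 x) := by
    unfold discount
    rw [discountedAt_eq]
    refine integral_mono (integrable_discountedValue M.β_pos.le M.β_lt_one hτ
      (v := fun _ => 1) (c := 1) (by simp)) (integrable_const _) fun ω => ?_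
    dsimp only [discountedValue]
    split_ifs with hω
    · exact M.β_pos.le
    · have h2 := h1 ω
      obtain ⟨n, hn⟩ := WithTop.ne_top_iff_exists.1 hω
      rw [← hn] at h2 ⊢
      have h3 : 1 ≤ n := WithTop.coe_le_coe.1 h2
      rw [WithTop.untopD_coe, mul_one]
      calc M.β ^ n ≤ M.β ^ 1 := pow_le_pow_of_le_one M.β_pos.le M.β_lt_one.le h3
        _ = M.β := pow_one _
  simpa using h

/-! ### First entry times -/

/-- Skip-freeness: a path below x cannot get above x without hitting it. -/
theorem lt_of_lt_entryTime {x y : ℕ} (hyx : y < x) :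
    ∀ᵐ ω ∂(chainLaw M.P0 y), ∀ t : ℕ, (t : WithTop ℕ) < entryTime x ω → ω t < x := by
  filter_upwards [chainLaw_zero M.P0 y, chainLaw_support M.P0 y] with ω h0 hs t
  induction t with
  | zero => intro _; rwa [h0]
  | succ t ih =>
    intro ht
    have h1 : ω t < x := ih (lt_of_le_of_lt (WithTop.coe_le_coe.2 t.le_succ) ht)
    have h2 : ω (t + 1) ≠ x := not_mem_of_lt_hittingAfter_one ht (Nat.le_add_left 1 t)
    rcases M.mem_support_P0 (hs t) with h | h | h <;> omega

theorem discount_entryTime {x y : ℕ} (hyx : y < x) :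
    M.discount y (entryTime x) = M.discHit y x := by
  -- Cutting off above x gives boundedness and is harmless, since before entry the one-step equation
  -- involves only states up to x.
  obtain ⟨d, hd⟩ := exists_bound_of_eventually_eq
    (v := fun z => if z ≤ x then M.discHit z x else 0) (w := fun _ => 0) (x := x + 1)
    (fun z hz => if_neg (by omega)) ⟨0, by simp⟩
  have h := integral_stoppedSum_add_discountedValue_of_harmonic M.β_pos.le M.β_lt_one
    (isStoppingTime_hittingAfter {x} 1) (P := M.P0) (a := y) (g := fun _ _ => 0) (c := 0)
    (by simp) hd ?_
  · have h1 : ∀ ω, stoppedSum M.β (hittingAfter (fun (t : ℕ) (ω : ℕ → ℕ) => ω t) {x} 1)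
        (fun _ _ => 0) ω = 0 := fun ω => by simp [stoppedSum]
    simp only [h1, integral_zero, zero_add, if_pos hyx.le] at h
    rw [← h, ← discountedAt_eq]
    refine M.discountedAt_congr fun ω hω => ?_
    have hx : ω ((entryTime x ω).untopD 0) = x := mem_of_hittingAfter_ne_top hω
    rw [hx, if_pos le_rfl, M.discHit_self]
  · filter_upwards [M.lt_of_lt_entryTime hyx] with ω hω t ht
    have hlt := hω t ht
    simp only [zero_add]
    rw [integral_const_mul, M.integral_P0 _ hd, if_pos hlt.le, if_pos (by omega),
      if_pos (Nat.zero_le _)]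
    exact M.discHit_step hlt

theorem costUntil_entryTime {x y : ℕ} (hyx : y < x) :
    M.costUntil y (entryTime x) = M.costHit y x := by
  obtain ⟨d, hd⟩ := exists_bound_of_eventually_eq
    (v := fun z => if z ≤ x then M.costHit z x else 0) (w := fun _ => 0) (x := x + 1)
    (fun z hz => if_neg (by omega)) ⟨0, by simp⟩
  obtain ⟨c, hc⟩ := M.periodCost_bounded
  have h := integral_stoppedSum_add_discountedValue_of_harmonic M.β_pos.le M.β_lt_one
    (isStoppingTime_hittingAfter {x} 1) (P := M.P0) (a := y) hc hd ?_
  · simp only [if_pos hyx.le] at h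
    rw [← h, ← costUntil_eq, ← discountedAt_eq]
    refine (add_eq_left.2 ?_).symm
    refine (M.discountedAt_congr (g := fun _ => 0) fun ω hω => ?_).trans ?_
    · rw [mem_of_hittingAfter_ne_top hω, if_pos le_rfl, M.costHit_self]
    · simp [discountedAt]
  · filter_upwards [M.lt_of_lt_entryTime hyx] with ω hω t ht
    have hlt := hω t ht
    rw [M.integral_periodCost_add _ hd, if_pos hlt.le, if_pos (by omega), if_pos (Nat.zero_le _)]
    exact M.costHit_step hlt

/-! ### The Gittins index -/

/-- Value in `z` of operating up to the first entry into `x`, if the machine is below `x`, and of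
stopping at once otherwise, when stopping in `y` costs `C y + l`. -/
noncomputable def stopValue (x : ℕ) (l : ℝ) (z : ℕ) : ℝ :=
  if z < x then M.costHit z x + M.discHit z x * (M.C x + l) else M.C z + l

theorem stopValue_of_le {x z : ℕ} (h : z ≤ x) (l : ℝ) :
    M.stopValue x l z = M.costHit z x + M.discHit z x * (M.C x + l) := by
  unfold stopValue
  split_ifs with hz
  · rfl
  · obtain rfl : z = x := by omega
    rw [M.costHit_self, M.discHit_self]; ring

theorem stopValue_of_ge {x z : ℕ} (h : x ≤ z) (l : ℝ) : M.stopValue x l z = M.C z + l :=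
  if_neg (by omega)

theorem stopValue_bounded (x : ℕ) (l : ℝ) : ∃ c, ∀ z, |M.stopValue x l z| ≤ c := by
  refine exists_bound_of_eventually_eq (fun z hz => M.stopValue_of_ge hz l) ?_
  obtain ⟨c, hc⟩ := M.C_bounded
  exact ⟨c + |l|, fun z => (abs_add_le _ _).trans (by linarith [hc z])⟩

theorem stopValue_step {x z : ℕ} (h : z < x) (l : ℝ) :
    M.K z + M.β * (M.p0 z z * M.stopValue x l z + M.p0 z (z + 1) * M.stopValue x l (z + 1) +
      M.failProb z * (M.B + M.stopValue x l 0)) = M.stopValue x l z := by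
  rw [M.stopValue_of_le h.le, M.stopValue_of_le h, M.stopValue_of_le (Nat.zero_le x)]
  linear_combination M.costHit_step h + (M.C x + l) * M.discHit_step h

/-- The denominator of `H`. -/
noncomputable def denH (x : ℕ) : ℝ := 1 - M.β + M.β * M.failProb x * (1 - M.discHit 0 x)

theorem denH_pos (x : ℕ) : 0 < M.denH x := by
  have h1 := M.β_lt_one
  have h2 := mul_nonneg (mul_nonneg M.β_pos.le (M.failProb_nonneg x))
    (sub_nonneg.2 (M.discHit_le_one (Nat.zero_le x)))
  unfold denH
  linarith

theorem H_mul_denH (x : ℕ) : M.H x * M.denH x =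
    M.K x + M.β * M.failProb x * (M.costHitZero x + M.B) + M.β * M.p0 x x * M.C x +
      M.β * M.p0 x (x + 1) * M.C (x + 1) + M.β * M.failProb x * M.discHit 0 x * M.C x -
      M.C x := by
  have hd := (M.denH_pos x).ne'
  have hden : M.denH x = if x = 0 then 1 - M.β else
      1 - (M.β * (1 - M.p0 x 0) + M.β * M.p0 x 0 * M.discHit 0 x) := by
    unfold denH failProb
    split_ifs <;> ring
  rw [hden] at hd ⊢
  unfold H failProb
  by_cases hx : x = 0
  · subst hx
    simp only [if_true] at hd ⊢
    rw [div_mul_cancel₀ _ hd]; ring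
  · simp only [if_neg hx] at hd ⊢
    rw [div_mul_cancel₀ _ hd]

/-- The gain of one more period of operation in `x` before following `stopValue x l`. -/
theorem stopping_gap (x : ℕ) (l : ℝ) :
    M.K x + M.β * (M.p0 x x * (M.C x + l) + M.p0 x (x + 1) * (M.C (x + 1) + l) +
      M.failProb x * (M.B + M.stopValue x l 0)) - (M.C x + l) = M.denH x * (M.H x - l) := by
  have h1 := M.H_mul_denH x
  rw [M.stopValue_of_le (Nat.zero_le x), M.costHit_zero]
  unfold denH at h1 ⊢
  linear_combination -h1 + M.β * l * M.p0_sum x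

/-- Below `x`, operating up to `x` is better than stopping if `H ≤ l` there. -/
theorem stopValue_le {x z : ℕ} (h : z ≤ x) {l : ℝ} (hl : ∀ y < x, M.H y ≤ l) :
    M.stopValue x l z ≤ M.C z + l := by
  rw [M.stopValue_of_le h]
  induction h using Nat.decreasingInduction with
  | self => rw [M.costHit_self, M.discHit_self]; linarith
  | of_succ y hy ih =>
    have h1 := M.one_sub_γ_mul_discHit_pos y
    have h0 := M.one_sub_pos y
    have h2 : M.costNext y + M.discHit y (y + 1) * (M.C (y + 1) + l) ≤ M.C y + l := by
      have hk := M.stopping_gap y l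
      rw [M.stopValue_of_le (Nat.zero_le y), M.costHit_zero] at hk
      have h3 := mul_nonneg (M.denH_pos y).le (sub_nonneg.2 (hl y hy))
      -- The two positive factors clear the geometric series of stays in y and of returns to y
      -- through failure; the difference of the two sides is then exactly -denH(y)(l - H(y)).
      have h4 : (1 - M.β * M.p0 y y) * (1 - M.γ y * M.discHit 0 y) *
          (M.costNext y + M.discHit y (y + 1) * (M.C (y + 1) + l)) ≤
          (1 - M.β * M.p0 y y) * (1 - M.γ y * M.discHit 0 y) * (M.C y + l) := by
        have e1 := M.one_sub_mul_costNext y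
        have e2 := M.one_sub_mul_discHit_succ y
        have e3 := M.one_sub_mul_δ y
        have e4 := M.one_sub_mul_κ y
        have e5 := M.one_sub_mul_γ y
        have e6 : (1 - M.β * M.p0 y y) * (1 - M.γ y * M.discHit 0 y) *
            (M.costNext y + M.discHit y (y + 1) * (M.C (y + 1) + l)) -
            (1 - M.β * M.p0 y y) * (1 - M.γ y * M.discHit 0 y) * (M.C y + l) =
            -(M.denH y * (l - M.H y)) := by
          linear_combination hk + (1 - M.β * M.p0 y y) * e1 +
            (1 - M.β * M.p0 y y) * (M.C (y + 1) + l) * e2 + (M.C (y + 1) + l) * e3 + e4 +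
            (M.costHitZero y + M.B + M.discHit 0 y * (M.C y + l)) * e5
        linarith
      exact le_of_mul_le_mul_left h4 (mul_pos h0 h1)
    have h5 := mul_le_mul_of_nonneg_left ih (M.discHit_nonneg y (y + 1))
    rw [M.costHit_of_lt hy, ← M.discHit_mul y.le_succ hy]
    linarith

theorem stopValue_zero_sub (x : ℕ) (l m : ℝ) :
    M.stopValue x m 0 - M.stopValue x l 0 = M.discHit 0 x * (m - l) := by
  rw [M.stopValue_of_le (Nat.zero_le x), M.stopValue_of_le (Nat.zero_le x)]
  ring

/-- A climb from 0 to z passes through x, so the two values differ by b(0,x) times the gain, at x,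
of going on to z over stopping. -/
theorem stopValue_zero_le {x z : ℕ} (h : x ≤ z) {l : ℝ} (hl : ∀ y < z, M.H y ≤ l) :
    M.stopValue z l 0 ≤ M.stopValue x l 0 := by
  have h1 := M.stopValue_le h hl
  rw [M.stopValue_of_le h] at h1
  rw [M.stopValue_of_le (Nat.zero_le x), M.stopValue_of_le (Nat.zero_le z), M.costHit_zero,
    M.costHit_zero, M.costHitZero_eq h, ← M.discHit_mul (Nat.zero_le x) h]
  nlinarith [mul_le_mul_of_nonneg_left h1 (M.discHit_nonneg 0 x)]

variable {M}

theorem stopValue_le_continue (hH : Monotone M.H) (x z : ℕ) :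
    M.stopValue x (M.H x) z ≤ M.K z + M.β * (M.p0 z z * M.stopValue x (M.H x) z +
      M.p0 z (z + 1) * M.stopValue x (M.H x) (z + 1) +
      M.failProb z * (M.B + M.stopValue x (M.H x) 0)) := by
  rcases lt_or_ge z x with hz | hz
  · exact (M.stopValue_step hz _).ge
  -- At charge H(z), continuing and stopping in z balance. Aiming at x instead of z can only raise
  -- the value at 0. Lowering the charge to H(x) then saves at least as much on stopping as on
  -- continuing; the excess is `h6`.
  · have h1 := M.stopping_gap z (M.H z)
    have h2 := M.stopValue_zero_le hz fun y hy => hH (Nat.le_of_lt hy)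
    have h3 := M.stopValue_zero_sub x (M.H x) (M.H z)
    have h4 := mul_le_mul_of_nonneg_left h2 (mul_nonneg M.β_pos.le (M.failProb_nonneg z))
    have h6 : 0 ≤ (1 - M.β + M.β * M.failProb z * (1 - M.discHit 0 x)) * (M.H z - M.H x) := by
      refine mul_nonneg ?_ (sub_nonneg.2 (hH hz))
      have := M.β_lt_one
      have := mul_nonneg (mul_nonneg M.β_pos.le (M.failProb_nonneg z))
        (sub_nonneg.2 (M.discHit_le_one (Nat.zero_le x)))
      linarith
    rw [M.stopValue_of_ge hz, M.stopValue_of_ge (z := z + 1) (by omega)]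
    have h7 := M.p0_sum z
    have h8 : M.p0 z z = 1 - M.p0 z (z + 1) - M.failProb z := by linarith
    rw [h8] at h1 ⊢
    have h9 : M.stopValue x (M.H z) 0 =
        M.stopValue x (M.H x) 0 + M.discHit 0 x * (M.H z - M.H x) := by linarith
    rw [h9] at h4
    linarith

theorem H_le_of_mem_gittinsRatios (hH : Monotone M.H) {x : ℕ} {r : ℝ}
    (hr : r ∈ M.gittinsRatios x) : M.H x ≤ r := by
  obtain ⟨τ, hτ, h1, rfl⟩ := hr
  obtain ⟨c, hc⟩ := M.periodCost_bounded
  obtain ⟨d, hd⟩ := M.stopValue_bounded x (M.H x)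
  obtain ⟨e, he⟩ := M.C_bounded
  have h := le_integral_stoppedSum_add_discountedValue M.β_pos.le M.β_lt_one hτ (P := M.P0)
    (a := x) hc hd fun z => by
      rw [M.integral_periodCost_add z hd]
      exact stopValue_le_continue hH x z
  have h2 := M.discountedAt_le hd (g := fun y => M.C y + M.H x) (d := e + |M.H x|)
    (fun y => (abs_add_le _ _).trans (by linarith [he y])) (fun y => ?_) x hτ
  · rw [M.discountedAt_add_const he _ x hτ] at h2
    rw [← costUntil_eq, ← discountedAt_eq, M.stopValue_of_ge le_rfl] at h
    rw [le_div_iff₀ (sub_pos.2 (M.discount_lt_one x hτ h1))]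
    linarith
  · rcases le_total y x with hy | hy
    · exact M.stopValue_le hy fun y hy => hH (Nat.le_of_lt hy)
    · exact (M.stopValue_of_ge hy _).le

theorem H_mem_gittinsRatios (M : Machine) (x : ℕ) : M.H x ∈ M.gittinsRatios x := by
  -- The optimal rule: operate once, then stop on first being in [x, ∞). After time 0 and before
  -- stopping the path is strictly below x, so the break-even identity is used only at time 0.
  have hτ := isStoppingTime_hittingAfter (Set.Ici x) 1
  have h1 : ∀ ω : ℕ → ℕ,
      1 ≤ hittingAfter (fun (t : ℕ) (ω : ℕ → ℕ) => ω t) (Set.Ici x) 1 ω :=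
    fun ω => le_hittingAfter (n := 1) ω
  refine ⟨_, hτ, h1, ?_⟩
  obtain ⟨c, hc⟩ := M.periodCost_bounded
  obtain ⟨d, hd⟩ := M.stopValue_bounded x (M.H x)
  obtain ⟨e, he⟩ := M.C_bounded
  have h := integral_stoppedSum_add_discountedValue_of_harmonic M.β_pos.le M.β_lt_one hτ
    (P := M.P0) (a := x) hc hd ?_
  · rw [← costUntil_eq, ← discountedAt_eq, M.stopValue_of_ge le_rfl,
      M.discountedAt_congr (g := fun y => M.C y + M.H x) fun ω hω =>
        M.stopValue_of_ge (Set.mem_Ici.1 (mem_of_hittingAfter_ne_top hω)) _,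
      M.discountedAt_add_const he _ x hτ] at h
    rw [eq_div_iff (sub_pos.2 (M.discount_lt_one x hτ h1)).ne']
    linarith
  · filter_upwards [chainLaw_zero M.P0 x] with ω h0 t ht
    rw [M.integral_periodCost_add _ hd]
    have hx : ω t = x ∨ ω t < x := by
      rcases Nat.eq_zero_or_pos t with rfl | h
      · exact Or.inl h0
      · exact Or.inr (not_le.1 (not_mem_of_lt_hittingAfter_one ht h))
    rcases hx with hx | hx
    · have h2 := M.stopping_gap x (M.H x)
      rw [hx, M.stopValue_of_ge (z := x) le_rfl, M.stopValue_of_ge (z := x + 1) x.le_succ]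
      linarith
    · exact M.stopValue_step hx _

theorem isLeast_gittinsRatios (hH : Monotone M.H) (x : ℕ) :
    IsLeast (M.gittinsRatios x) (M.H x) :=
  ⟨M.H_mem_gittinsRatios x, fun _ hr => H_le_of_mem_gittinsRatios hH hr⟩

theorem G_eq_H (hH : Monotone M.H) (x : ℕ) : M.G x = M.H x :=
  (isLeast_gittinsRatios hH x).csInf_eq

end Machine

theorem PMF.integral_bind {α β : Type} [MeasurableSpace α] [DiscreteMeasurableSpace α]
    [Countable α] [MeasurableSpace β] [DiscreteMeasurableSpace β] (p : PMF α) (q : α → PMF β)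
    {f : β → ℝ} {c : ℝ} (hf : ∀ y, |f y| ≤ c) :
    ∫ y, f y ∂(p.bind q).toMeasure = ∫ x, ∫ y, f y ∂(q x).toMeasure ∂p.toMeasure := by
  let κ : Kernel α β := Kernel.ofFunOfCountable fun x => (q x).toMeasure
  have hκ : IsMarkovKernel κ := ⟨fun x => PMF.toMeasure.isProbabilityMeasure (q x)⟩
  have h : (p.bind q).toMeasure = (κ ∘ₖ Kernel.const Unit p.toMeasure) () := by
    ext s hs
    rw [Kernel.comp_apply' _ _ _ hs, PMF.toMeasure_bind_apply _ _ _ hs, Kernel.const_apply,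
      lintegral_countable']
    refine tsum_congr fun x => ?_
    rw [PMF.toMeasure_apply_singleton _ _ (measurableSet_singleton x), mul_comm]
    rfl
  have hm : Measurable f := Measurable.of_discrete
  rw [h, Kernel.integral_comp (integrable_of_bounded hm hf), Kernel.const_apply]
  rfl

/-! ### The intervention policy and the W-index -/

namespace Machine

variable (M : Machine)

theorem p1_nonneg (x y : ℕ) : 0 ≤ M.p1 x y := ENNReal.toReal_nonneg

theorem p1_sum {x : ℕ} (hx : 0 < x) : ∑ y ∈ Finset.range x, M.p1 x y = 1 := by
  unfold p1
  rw [← ENNReal.toReal_sum fun y _ => (M.P1 x).apply_ne_top y, M.intervention_below x hx]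
  simp

theorem integral_P1 {x : ℕ} (hx : 0 < x) {f : ℕ → ℝ} {c : ℝ} (hf : ∀ y, |f y| ≤ c) :
    ∫ y, f y ∂(M.P1 x).toMeasure = ∑ y ∈ Finset.range x, M.p1 x y * f y :=
  (M.P1 x).integral_eq_sum_of_sum_eq_one (M.intervention_below x hx) hf

/-- Expectation over one epoch of the policy that intervenes in `x`. -/
theorem integral_policyStep {x : ℕ} (hx : 0 < x) (z : ℕ × ℕ) {f : ℕ × ℕ → ℝ} {c : ℝ}
    (hf : ∀ w, |f w| ≤ c) :
    ∫ w, f w ∂(M.policyStep x z).toMeasure = ∫ s, (if s = x then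
      ∑ y ∈ Finset.range x, M.p1 x y * f (x, y) else f (s, s)) ∂(M.P0 z.2).toMeasure := by
  unfold policyStep
  rw [PMF.integral_bind _ _ hf]
  refine integral_congr_ae (ae_of_all _ fun s => ?_)
  have hm : Measurable f := Measurable.of_discrete
  dsimp only
  split_ifs with hs
  · subst hs
    have hpair : Measurable fun y : ℕ => (s, y) := Measurable.of_discrete
    rw [← PMF.toMeasure_map (p := M.P1 s) (hf := hpair),
      integral_map hpair.aemeasurable hm.aestronglyMeasurable,
      M.integral_P1 hx fun y => hf (s, y)]
  · rw [PMF.toMeasure_pure, integral_dirac]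

/-- The policy never operates in x or above, so one-step equations below x suffice. -/
theorem snd_lt_of_mem_support_policyStep {x : ℕ} (hx : 0 < x) {z w : ℕ × ℕ} (hz : z.2 < x)
    (hw : w ∈ (M.policyStep x z).support) : w.2 < x := by
  unfold policyStep at hw
  obtain ⟨s, hs, hws⟩ := (PMF.mem_support_bind_iff _ _ _).1 hw
  split_ifs at hws with h
  · obtain ⟨y, hy, rfl⟩ := (PMF.mem_support_map_iff _ _ _).1 hws
    by_contra hn
    exact hy ((M.P1 x).eq_zero_of_sum_eq_one (M.intervention_below x hx)
      (by simpa using hn))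
  · obtain rfl := (PMF.mem_support_pure_iff _ _).1 hws
    have := M.mem_support_P0 hs
    dsimp only
    omega

/-- `E[β^{τ(Y,x)}]` for the state `Y` after an intervention in `x`. -/
noncomputable def meanDisc (x : ℕ) : ℝ := ∑ y ∈ Finset.range x, M.p1 x y * M.discHit y x

/-- `E[K(Y,τ(Y,x))]` for the state `Y` after an intervention in `x`. -/
noncomputable def meanCost (x : ℕ) : ℝ := ∑ y ∈ Finset.range x, M.p1 x y * M.costHit y x

theorem meanDisc_lt_one {x : ℕ} (hx : 0 < x) : M.meanDisc x < 1 := by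
  rw [← M.p1_sum hx]
  have h1 : ∑ y ∈ Finset.range x, M.p1 x y ≠ 0 := by rw [M.p1_sum hx]; exact one_ne_zero
  obtain ⟨y, hy, hy0⟩ := Finset.exists_ne_zero_of_sum_ne_zero h1
  refine Finset.sum_lt_sum (fun y hy => ?_) ⟨y, hy, ?_⟩
  · exact mul_le_of_le_one_right (M.p1_nonneg x y) (M.discHit_le_one (Finset.mem_range.1 hy).le)
  · exact mul_lt_of_lt_one_right (lt_of_le_of_ne (M.p1_nonneg x y) (Ne.symm hy0))
      (M.discHit_lt_one (Finset.mem_range.1 hy))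

theorem isStoppingTime_top {α : Type} [MeasurableSpace α] :
    IsStoppingTime (Filtration.piLE (X := fun _ : ℕ => α)) fun _ => ⊤ := by
  intro i
  have h : {ω : ℕ → α | (⊤ : WithTop ℕ) ≤ (i : WithTop ℕ)} = ∅ := by
    ext ω
    exact iff_of_false (not_le.2 (WithTop.coe_lt_top i)) (Set.notMem_empty ω)
  exact h ▸ @MeasurableSet.empty _ (Filtration.piLE (X := fun _ : ℕ => α) i)

theorem policyCost_eq {x y : ℕ} (hyx : y < x) (W : ℝ) :
    M.policyCost x y W = M.costHit y x +
      M.discHit y x * ((M.C x + W + M.meanCost x) / (1 - M.meanDisc x)) := by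
  have hx : 0 < x := by omega
  set a := (M.C x + W + M.meanCost x) / (1 - M.meanDisc x) with ha
  -- Renewal equation: a is the cost from the moment the machine is found in x, charge included.
  have ha' : a = M.C x + W + (M.meanCost x + M.meanDisc x * a) := by
    have h := (sub_pos.2 (M.meanDisc_lt_one hx)).ne'
    rw [ha]; field_simp; ring
  clear_value a
  obtain ⟨f, hf⟩ : ∃ f : ℕ → ℝ, f = fun u =>
    if u ≤ x then M.costHit u x + M.discHit u x * a else 0 := ⟨_, rfl⟩
  have hfle : ∀ u ≤ x, f u = M.costHit u x + M.discHit u x * a := fun u hu => by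
    rw [hf]; exact if_pos hu
  have hfx : f x = a := by rw [hfle x le_rfl, M.costHit_self, M.discHit_self]; ring
  obtain ⟨d, hd⟩ := exists_bound_of_eventually_eq (v := f) (w := fun _ => 0) (x := x + 1)
    (fun z hz => by rw [hf]; exact if_neg (by omega)) ⟨0, by simp⟩
  obtain ⟨c, hc⟩ := M.periodCost_bounded
  have hchg : ∀ s : ℕ, |if s = x then M.C x + W else 0| ≤ |M.C x + W| := fun s => by
    split_ifs <;> simp
  have hg : ∀ z w : ℕ × ℕ, |(if z.1 = x then M.C x + W else 0) + M.periodCost z.2 w.1| ≤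
      |M.C x + W| + c := fun z w => (abs_add_le _ _).trans (add_le_add (hchg _) (hc _ _))
  have hv : ∀ z : ℕ × ℕ, |(if z.1 = x then M.C x + W else 0) + f z.2| ≤ |M.C x + W| + d :=
    fun z => (abs_add_le _ _).trans (add_le_add (hchg _) (hd _))
  have h := integral_stoppedSum_add_discountedValue_of_harmonic M.β_pos.le M.β_lt_one
    (isStoppingTime_top (α := ℕ × ℕ)) (P := M.policyStep x) (a := (y, y)) hg hv ?_
  · have h1 : ∀ v : ℕ × ℕ → ℝ, ∀ ω,
        discountedValue M.β (fun _ => ⊤) v ω = 0 := fun v ω => if_pos rfl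
    simp only [h1, integral_zero, add_zero, if_neg hyx.ne, zero_add] at h
    rw [← hfle y hyx.le, ← h]
    refine integral_congr_ae (ae_of_all _ fun ω => tsum_congr fun t => ?_)
    exact (if_pos (WithTop.coe_lt_top t)).symm
  · filter_upwards [chainLaw_zero (M.policyStep x) (y, y), chainLaw_support (M.policyStep x) (y, y)]
      with ω h0 hs t ht
    have hlt : (ω t).2 < x := by
      clear ht
      induction t with
      | zero => rw [h0]; exact hyx
      | succ t ih => exact M.snd_lt_of_mem_support_policyStep hx ih (hs t)
    generalize ω t = z at hlt
    rw [M.integral_policyStep hx z (c := (|M.C x + W| + c) + M.β * (|M.C x + W| + d)) fun w =>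
      (abs_add_le _ _).trans (add_le_add (hg z w) (by
        rw [abs_mul, abs_of_pos M.β_pos]
        exact mul_le_mul_of_nonneg_left (hv w) M.β_pos.le))]
    have hsum : ∑ u ∈ Finset.range x, M.p1 x u * f u = M.meanCost x + M.meanDisc x * a := by
      unfold meanCost meanDisc
      rw [Finset.sum_mul, ← Finset.sum_add_distrib]
      refine Finset.sum_congr rfl fun u hu => ?_
      rw [hfle u (Finset.mem_range.1 hu).le]; ring
    -- Averaging over the state after intervention, the charge and continuation at x add up to a =
    -- f(x), so one epoch of the policy reduces to one period of plain operation with value f.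
    have hred : ∀ s, (if s = x then ∑ u ∈ Finset.range x, M.p1 x u *
        ((if z.1 = x then M.C x + W else 0) + M.periodCost z.2 x +
          M.β * ((if x = x then M.C x + W else 0) + f u)) else
        ((if z.1 = x then M.C x + W else 0) + M.periodCost z.2 s +
          M.β * ((if s = x then M.C x + W else 0) + f s))) =
        (if z.1 = x then M.C x + W else 0) + (M.periodCost z.2 s + M.β * f s) := by
      intro s
      generalize (if z.1 = x then M.C x + W else 0) = e
      split_ifs with hs hxx
      · have hpull : ∀ A B : ℝ, ∑ u ∈ Finset.range x, M.p1 x u * (A + M.β * (B + f u)) =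
            A + M.β * (B + (M.meanCost x + M.meanDisc x * a)) := fun A B => by
          rw [← hsum]
          calc _ = ∑ u ∈ Finset.range x, (M.p1 x u * (A + M.β * B) + M.β * (M.p1 x u * f u)) :=
                Finset.sum_congr rfl fun u _ => by ring
            _ = _ := by
                rw [Finset.sum_add_distrib, ← Finset.sum_mul, ← Finset.mul_sum, M.p1_sum hx]
                ring
        rw [hpull, hs, hfx]
        linear_combination (-M.β) * ha'
      · exact absurd rfl hxx
      · ring
    have hm : ∀ F : ℕ → ℝ, Measurable F := fun F => Measurable.of_discrete
    have hint : Integrable (fun s => M.periodCost z.2 s + M.β * f s) (M.P0 z.2).toMeasure :=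
      integrable_of_bounded (hm _) (c := c + M.β * d) fun s =>
        (abs_add_le _ _).trans (add_le_add (hc _ _) (by
          rw [abs_mul, abs_of_pos M.β_pos]
          exact mul_le_mul_of_nonneg_left (hd s) M.β_pos.le))
    have hstep := M.costHit_step hlt
    have hdisc := M.discHit_step hlt
    refine (integral_congr_ae (ae_of_all _ hred)).trans ?_
    rw [integral_add (integrable_const _) hint, M.integral_periodCost_add _ hd,
      hfle z.2 hlt.le, hfle (z.2 + 1) hlt, hfle 0 (Nat.zero_le x), integral_const]
    simp only [probReal_univ, one_smul]
    linear_combination hstep + a * hdisc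

theorem frakB_eq {x : ℕ} (hx : 0 < x) (W : ℝ) :
    M.frakB x W = (W + M.meanCost x + M.meanDisc x * M.C x) / (1 - M.meanDisc x) := by
  have h : M.frakB x W = M.meanCost x +
      M.meanDisc x * ((M.C x + W + M.meanCost x) / (1 - M.meanDisc x)) + W := by
    unfold frakB meanCost meanDisc
    rw [Finset.sum_mul, ← Finset.sum_add_distrib]
    congr 1
    refine Finset.sum_congr rfl fun y hy => ?_
    rw [M.policyCost_eq (Finset.mem_range.1 hy)]
    unfold meanCost meanDisc
    ring
  have hne := (sub_pos.2 (M.meanDisc_lt_one hx)).ne'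
  rw [h]; field_simp; ring

theorem frakB_zero (W : ℝ) : M.frakB 0 W = W := by simp [frakB]

/-- Only monotonicity of `frakB x` in W matters; the value of G plays no role. -/
theorem indexable : M.Indexable := by
  intro W₁ W₂ hW x hx
  change M.G x ≤ M.frakB x W₁ at hx
  refine hx.trans ?_
  rcases Nat.eq_zero_or_pos x with rfl | h
  · simpa only [frakB_zero] using hW
  · rw [M.frakB_eq h, M.frakB_eq h]
    exact div_le_div_of_nonneg_right (by linarith) (sub_pos.2 (M.meanDisc_lt_one h)).le

theorem setOf_mem_operationSet {x : ℕ} (hx : 0 < x) :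
    {W : ℝ | x ∈ M.operationSet W} =
      Set.Ici (M.G x * (1 - M.meanDisc x) - M.meanDisc x * M.C x - M.meanCost x) := by
  ext W
  change M.G x ≤ M.frakB x W ↔ _ ≤ W
  rw [M.frakB_eq hx, le_div_iff₀ (sub_pos.2 (M.meanDisc_lt_one hx))]
  constructor <;> intro h <;> linarith

end Machine

theorem mainTheorem3 (M : Machine) (hH : Monotone M.H) :
    -- the Gittins index, a genuine infimum, is `H`
    (∀ x : ℕ, IsGLB (M.gittinsRatios x) (M.G x) ∧ M.H x = M.G x) ∧
    -- the machine is indexable, and the `W`-index, a genuine infimum, is explicit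
    M.Indexable ∧
    ∀ x : ℕ, 0 < x →
      (∀ y < x, M.discount y (Machine.entryTime x) = M.discHit y x ∧
        M.costUntil y (Machine.entryTime x) = M.costHit y x) ∧
      IsGLB {W : ℝ | x ∈ M.operationSet W} (M.whittle x) ∧
      M.whittle x =
        M.H x * (1 - ∑ y ∈ Finset.range x, M.p1 x y *
            ((∏ h ∈ Finset.Ico y x, M.δ h) *
              (1 - ∑ i ∈ Finset.range y, M.γ i * ∏ z ∈ Finset.range i, M.δ z) /
              (1 - ∑ i ∈ Finset.range x, M.γ i * ∏ z ∈ Finset.range i, M.δ z)))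
        - (∑ y ∈ Finset.range x, M.p1 x y *
            ((∏ h ∈ Finset.Ico y x, M.δ h) *
              (1 - ∑ i ∈ Finset.range y, M.γ i * ∏ z ∈ Finset.range i, M.δ z) /
              (1 - ∑ i ∈ Finset.range x, M.γ i * ∏ z ∈ Finset.range i, M.δ z))) * M.C x
        - ∑ y ∈ Finset.range x, M.p1 x y * M.costUntil y (Machine.entryTime x) := by
  refine ⟨fun x => ⟨?_, (Machine.G_eq_H hH x).symm⟩, M.indexable, fun x hx =>
    ⟨fun y hy => ⟨M.discount_entryTime hy, M.costUntil_entryTime hy⟩, ?_⟩⟩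
  · rw [Machine.G_eq_H hH x]
    exact (Machine.isLeast_gittinsRatios hH x).isGLB
  · have hcost : ∑ y ∈ Finset.range x, M.p1 x y * M.costUntil y (Machine.entryTime x) =
        M.meanCost x := Finset.sum_congr rfl fun y hy => by
      rw [M.costUntil_entryTime (Finset.mem_range.1 hy)]
    rw [hcost, Machine.whittle, M.setOf_mem_operationSet hx, csInf_Ici, Machine.G_eq_H hH x]
    exact ⟨isGLB_Ici, rfl⟩
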